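/- Let $W$ be a finite-dimensional complex vector space, let $\psi\colon W\otimes W\to W\otimes W$ be a linear map with $\psi^2=\mathrm{id}$ satisfying the braid equation $(\psi\otimes\mathrm{id})(\mathrm{id}\otimes\psi)(\psi\otimes\mathrm{id})=(\mathrm{id}\otimes\psi)(\psi\otimes\mathrm{id})(\mathrm{id}\otimes\psi)$, and let $F\colon W\otimes W\to\mathbb C$ be a linear form with $(F\otimes\mathrm{id})(\mathrm{id}\otimes\psi)=(\mathrm{id}\otimes F)(\psi\otimes\mathrm{id})$ and $F\psi=F$. For such data, let $A$ be the total antisymmetrizer of the tensor algebra $W^{\otimes}$, given by $A_n=\sum_{\pi\in S_n}(-1)^\pi\psi_\pi$ on $W^{\otimes n}$, where $\psi_\pi$ is obtained by replacing the adjacent transpositions in a minimal decomposition of $\pi$ by the corresponding $\psi$-twists. For $x\in W$ let $\iota^F_x\colon W^\otimes\to W^\otimes$ be the contraction determined by $\iota^F_x(1)=0$ and $\iota^F_x(y\otimes\vartheta)=F(x,y)\vartheta-\sum_k y_k\otimes\iota^F_{x_k}(\vartheta)$, where $\psi(x\otimes y)=\sum_k y_k\otimes x_k$; let $\lambda_F\colon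 W^\otimes\to W^\otimes$ be given by $\lambda_F(1)=1$ and $\lambda_F(x\otimes\vartheta)=x\otimes\lambda_F(\vartheta)+\iota^F_x\lambda_F(\vartheta)$. The braided Clifford algebra is $\mathrm{cl}(W,\psi,F)=W^\otimes/J_F$ with $J_F=\lambda_F^{-1}[\ker A]$. Put $\mathcal A_F=\mathrm{cl}(W,\psi,F)$ with product $m_F$. On $W\oplus W$ let $\Psi$ be the braid that maps the $(i,j)$ summand $W\otimes W$ of $(W\oplus W)^{\otimes 2}$ to the $(j,i)$ summand by $\psi$ ($i,j\in\{1,2\}$), and let $E$ be the form equal to $F$ on the summands with $i=j$ and to $-F/2$ on those with $i\ne j$. Let $\ell_-,\ell_+,\Delta^*\colon\mathcal A_F\to\mathrm{cl}(W\oplus W,\Psi,E)$ be the unital algebra homomorphisms with $\ell_-(x)=(x,0)$, $\ell_+(x)=(0,x)$, $\Delta^*(x)=(x,x)$ for $x\in W$, and let $\ell_F\colon\mathcal A_F\otimes\mathcal A_F\to\mathrm{cl}(W\oplus W,\Psi,E)$ be the linear map $\ell_F(a\otimes b)=\ell_-(a)\ell_+(b)$. Then: 1. There is a unique linear operator $\sigma_F$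 on $\mathcal A_F\otimes\mathcal A_F$ such that $(m_F\otimes\mathrm{id})(\mathrm{id}\otimes\sigma_F)(\sigma_F\otimes\mathrm{id})=\sigma_F(\mathrm{id}\otimes m_F)$, $(\mathrm{id}\otimes m_F)(\sigma_F\otimes\mathrm{id})(\mathrm{id}\otimes\sigma_F)=\sigma_F(m_F\otimes\mathrm{id})$, $\sigma_F(1\otimes a)=a\otimes1$ and $\sigma_F(a\otimes1)=1\otimes a$ for $a\in\mathcal A_F$, and $\sigma_F(x\otimes y)=-\psi(x\otimes y)-F(x,y)1\otimes1$ for $x,y\in W$. The product $(a\otimes b)(c\otimes d)=a\,\sigma_F(b\otimes c)\,d$ on $\mathcal A_F\otimes\mathcal A_F$ is associative with unit $1\otimes1$. 2. With respect to this product, $\ell_F$ is an isomorphism of unital algebras from $\mathcal A_F\otimes\mathcal A_F$ onto $\mathrm{cl}(W\oplus W,\Psi,E)$. 3. There is a unique unital homomorphism $\phi\colon\mathcal A_F\to\mathcal A_F\otimes\mathcal A_F$ (for this product) with $\phi(x)=1\otimes x+x\otimes1$ for $x\in W$, and $\Delta^*=\ell_F\phi$. -/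

import Mathlib

open scoped TensorProduct

noncomputable section

namespace BraidedCliff

universe u

section Tensors

variable {V : Type u} [AddCommGroup V] [Module ℂ V]

/-- `f ⊗ id` on `V ⊗ V ⊗ V`. -/
def onLeft (f : V ⊗[ℂ] V →ₗ[ℂ] V ⊗[ℂ] V) :
    (V ⊗[ℂ] V) ⊗[ℂ] V →ₗ[ℂ] (V ⊗[ℂ] V) ⊗[ℂ] V :=
  f.rTensor V

/-- `id ⊗ f` on `V ⊗ V ⊗ V`. -/
def onRight (f : V ⊗[ℂ] V →ₗ[ℂ] V ⊗[ℂ] V) :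
    (V ⊗[ℂ] V) ⊗[ℂ] V →ₗ[ℂ] (V ⊗[ℂ] V) ⊗[ℂ] V :=
  (TensorProduct.assoc ℂ V V V).symm.toLinearMap ∘ₗ f.lTensor V ∘ₗ
    (TensorProduct.assoc ℂ V V V).toLinearMap

/-- The braid equation `(ψ ⊗ id)(id ⊗ ψ)(ψ ⊗ id) = (id ⊗ ψ)(ψ ⊗ id)(id ⊗ ψ)`. -/
def BraidEquation (ψ : V ⊗[ℂ] V →ₗ[ℂ] V ⊗[ℂ] V) : Prop :=
  onLeft ψ ∘ₗ onRight ψ ∘ₗ onLeft ψ = onRight ψ ∘ₗ onLeft ψ ∘ₗ onRight ψ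

/-- The compatibility `(F ⊗ id)(id ⊗ ψ) = (id ⊗ F)(ψ ⊗ id)` of a form and a braid. -/
def CovariantForm (ψ : V ⊗[ℂ] V →ₗ[ℂ] V ⊗[ℂ] V) (F : V ⊗[ℂ] V →ₗ[ℂ] ℂ) : Prop :=
  (TensorProduct.lid ℂ V).toLinearMap ∘ₗ F.rTensor V ∘ₗ onRight ψ =
    (TensorProduct.rid ℂ V).toLinearMap ∘ₗ F.lTensor V ∘ₗ
      (TensorProduct.assoc ℂ V V V).toLinearMap ∘ₗ onLeft ψ

end Tensors

section TensorAlg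

variable {W : Type u} [AddCommGroup W] [Module ℂ W]

/-- The left multiplication `x ⊗ t ↦ x t`, `W ⊗ T(W) → T(W)`. -/
def cons (W : Type u) [AddCommGroup W] [Module ℂ W] :
    W ⊗[ℂ] TensorAlgebra ℂ W →ₗ[ℂ] TensorAlgebra ℂ W :=
  LinearMap.mul' ℂ (TensorAlgebra ℂ W) ∘ₗ (TensorAlgebra.ι ℂ).rTensor (TensorAlgebra ℂ W)

@[simp] theorem cons_tmul (x : W) (t : TensorAlgebra ℂ W) :
    cons W (x ⊗ₜ t) = TensorAlgebra.ι ℂ x * t := by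
  simp [cons]

/-- Auxiliary operators for `leftRec`: `x` acts on `(t, n)` as `(x t, g x (t, n))`. -/
def leftRecStep {N : Type u} [AddCommGroup N] [Module ℂ N]
    (g : W →ₗ[ℂ] TensorAlgebra ℂ W × N →ₗ[ℂ] N) :
    W →ₗ[ℂ] Module.End ℂ (TensorAlgebra ℂ W × N) where
  toFun x := (LinearMap.mulLeft ℂ (TensorAlgebra.ι ℂ x) ∘ₗ LinearMap.fst ℂ _ _).prod (g x)
  map_add' x y := by
    apply LinearMap.ext
    intro p
    ext <;> simp [add_mul]
  map_smul' c x := by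
    apply LinearMap.ext
    intro p
    ext <;> simp

/-- Recursion on tensors from the left: the linear map `f` on `T(W)` determined by
`f 1 = n₀` and `f (x t) = g x (t, f t)` for `x ∈ W`. -/
def leftRec {N : Type u} [AddCommGroup N] [Module ℂ N] (n₀ : N)
    (g : W →ₗ[ℂ] TensorAlgebra ℂ W × N →ₗ[ℂ] N) : TensorAlgebra ℂ W →ₗ[ℂ] N :=
  LinearMap.snd ℂ _ _ ∘ₗ
    LinearMap.applyₗ ((1 : TensorAlgebra ℂ W), n₀) ∘ₗ
      (TensorAlgebra.lift ℂ (leftRecStep g)).toLinearMap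

theorem leftRec_fst {N : Type u} [AddCommGroup N] [Module ℂ N]
    (g : W →ₗ[ℂ] TensorAlgebra ℂ W × N →ₗ[ℂ] N) (t : TensorAlgebra ℂ W) :
    ∀ p : TensorAlgebra ℂ W × N, (TensorAlgebra.lift ℂ (leftRecStep g) t p).1 = t * p.1 := by
  induction t using TensorAlgebra.induction with
  | algebraMap r => intro p; simp [Algebra.smul_def]
  | ι x => intro p; simp [leftRecStep]
  | mul a b ha hb => intro p; simp [ha, hb, mul_assoc]
  | add a b ha hb => intro p; simp [ha, hb, add_mul]

@[simp] theorem leftRec_one {N : Type u} [AddCommGroup N] [Module ℂ N] (n₀ : N)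
    (g : W →ₗ[ℂ] TensorAlgebra ℂ W × N →ₗ[ℂ] N) : leftRec n₀ g 1 = n₀ := by
  simp [leftRec]

@[simp] theorem leftRec_cons {N : Type u} [AddCommGroup N] [Module ℂ N] (n₀ : N)
    (g : W →ₗ[ℂ] TensorAlgebra ℂ W × N →ₗ[ℂ] N) (x : W) (t : TensorAlgebra ℂ W) :
    leftRec n₀ g (TensorAlgebra.ι ℂ x * t) = g x (t, leftRec n₀ g t) := by
  have h : TensorAlgebra.lift ℂ (leftRecStep g) t (1, n₀) = (t, leftRec n₀ g t) := by
    ext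
    · simp [leftRec_fst]
    · simp [leftRec]
  change (TensorAlgebra.lift ℂ (leftRecStep g) (TensorAlgebra.ι ℂ x * t) (1, n₀)).2 = _
  rw [map_mul, Module.End.mul_apply, h]
  simp [leftRecStep]

/-- Splitting off the first factor: `1 ↦ 0` and `x t ↦ x ⊗ t` for `x ∈ W`. -/
def uncons (W : Type u) [AddCommGroup W] [Module ℂ W] :
    TensorAlgebra ℂ W →ₗ[ℂ] W ⊗[ℂ] TensorAlgebra ℂ W :=
  leftRec 0 ((TensorProduct.mk ℂ W (TensorAlgebra ℂ W)).compl₂ (LinearMap.fst ℂ _ _))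

@[simp] theorem uncons_one : uncons W 1 = 0 := by simp [uncons]

@[simp] theorem uncons_cons (x : W) (t : TensorAlgebra ℂ W) :
    uncons W (TensorAlgebra.ι ℂ x * t) = x ⊗ₜ t := by simp [uncons]

/-- Left induction on tensors. -/
theorem left_induction {P : TensorAlgebra ℂ W → Prop} (h1 : P 1)
    (hc : ∀ x t, P t → P (TensorAlgebra.ι ℂ x * t)) (hs : ∀ (c : ℂ) t, P t → P (c • t))
    (ha : ∀ s t, P s → P t → P (s + t)) (t : TensorAlgebra ℂ W) : P t := by
  have key : ∀ s, P s → P (t * s) := by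
    induction t using TensorAlgebra.induction with
    | algebraMap r => intro s h; rw [← Algebra.smul_def]; exact hs r s h
    | ι x => intro s h; exact hc x s h
    | mul a b iha ihb => intro s h; rw [mul_assoc]; exact iha _ (ihb _ h)
    | add a b iha ihb => intro s h; rw [add_mul]; exact ha _ _ (iha _ h) (ihb _ h)
  simpa using key 1 h1

/-- `id^i ⊗ ψ ⊗ id^(n-i-2)` on `W^{⊗n}`, for `i + 2 ≤ n` (the twist of the tensor factors with
the zero-based numbers `i` and `i + 1`). Tensors with fewer than `i + 2` factors are mapped to `0`;
this value is never used. -/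
def twist (ψ : W ⊗[ℂ] W →ₗ[ℂ] W ⊗[ℂ] W) : ℕ → TensorAlgebra ℂ W →ₗ[ℂ] TensorAlgebra ℂ W
  | 0 => cons W ∘ₗ (cons W).lTensor W ∘ₗ
      (TensorProduct.assoc ℂ W W (TensorAlgebra ℂ W)).toLinearMap ∘ₗ
      ψ.rTensor (TensorAlgebra ℂ W) ∘ₗ
      (TensorProduct.assoc ℂ W W (TensorAlgebra ℂ W)).symm.toLinearMap ∘ₗ
      (uncons W).lTensor W ∘ₗ uncons W
  | i + 1 => cons W ∘ₗ (twist ψ i).lTensor W ∘ₗ uncons W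

/-- The permutation `s_{i₁} ⋯ s_{i_k}` of a word in the adjacent transpositions
`s_i = (i, i + 1)` of `n + 1` letters. -/
def wordPerm {n : ℕ} (l : List (Fin n)) : Equiv.Perm (Fin (n + 1)) :=
  (l.map fun i => Equiv.swap i.castSucc i.succ).prod

/-- The operator `ψ_{i₁} ⋯ ψ_{i_k}` of a word, `ψ_i` being the twist of the factors
`i` and `i + 1`. -/
def wordOp (ψ : W ⊗[ℂ] W →ₗ[ℂ] W ⊗[ℂ] W) {n : ℕ} (l : List (Fin n)) :
    Module.End ℂ (TensorAlgebra ℂ W) :=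
  (l.map fun i : Fin n => (twist ψ (i : ℕ) : Module.End ℂ (TensorAlgebra ℂ W))).prod

theorem exists_minWord {n : ℕ} (π : Equiv.Perm (Fin (n + 1))) :
    ∃ l : List (Fin n), wordPerm l = π ∧
      ∀ l' : List (Fin n), wordPerm l' = π → l.length ≤ l'.length := by
  have hne : ∃ k, ∃ l : List (Fin n), wordPerm l = π ∧ l.length = k := by
    have hπ : π ∈ Submonoid.closure
        (Set.range fun i : Fin n => Equiv.swap i.castSucc i.succ) := by
      rw [Equiv.Perm.mclosure_swap_castSucc_succ]; trivial
    obtain ⟨l, hl⟩ : ∃ l : List (Fin n), wordPerm l = π := by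
      induction hπ using Submonoid.closure_induction with
      | mem x hx => obtain ⟨i, rfl⟩ := hx; exact ⟨[i], by simp [wordPerm]⟩
      | one => exact ⟨[], by simp [wordPerm]⟩
      | mul x y _ _ hx hy =>
        obtain ⟨a, rfl⟩ := hx
        obtain ⟨b, rfl⟩ := hy
        exact ⟨a ++ b, by simp [wordPerm]⟩
    exact ⟨_, l, hl, rfl⟩
  classical
  obtain ⟨l, hl, hk⟩ := Nat.find_spec hne
  exact ⟨l, hl, fun l' hl' => hk ▸ Nat.find_min' hne ⟨l', hl', rfl⟩⟩

/-- A decomposition of `π` into adjacent transpositions of minimal length. -/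
def minWord {n : ℕ} (π : Equiv.Perm (Fin (n + 1))) : List (Fin n) :=
  (exists_minWord π).choose

/-- The antisymmetrizer `A_n = ∑_π (-1)^π ψ_π` on tensors of degree `n`, where `ψ_π` is obtained
from a minimal decomposition of `π`. (`A_0 = id`.) -/
def antisymDeg (ψ : W ⊗[ℂ] W →ₗ[ℂ] W ⊗[ℂ] W) : ℕ → Module.End ℂ (TensorAlgebra ℂ W)
  | 0 => LinearMap.id
  | n + 1 => ∑ π : Equiv.Perm (Fin (n + 1)),
      (((Equiv.Perm.sign π : ℤ) : ℂ)) • wordOp ψ (minWord π)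

/-- The total antisymmetrizer `A : T(W) → T(W)`, equal to `A_n` on tensors of degree `n`. -/
def antisym (ψ : W ⊗[ℂ] W →ₗ[ℂ] W ⊗[ℂ] W) : TensorAlgebra ℂ W →ₗ[ℂ] TensorAlgebra ℂ W :=
  DirectSum.toModule ℂ ℕ (TensorAlgebra ℂ W)
      (fun n => antisymDeg ψ n ∘ₗ
        ((LinearMap.range (TensorAlgebra.ι ℂ : W →ₗ[ℂ] TensorAlgebra ℂ W)) ^ n).subtype) ∘ₗ
    (DirectSum.decomposeLinearEquiv
      (fun n : ℕ => (LinearMap.range (TensorAlgebra.ι ℂ : W →ₗ[ℂ] TensorAlgebra ℂ W)) ^ n)).toLinearMap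

/-- The value `x ↦ F(x, y) t - ∑ y_k h(x_k)`, where `ψ(x ⊗ y) = ∑ y_k ⊗ x_k`. -/
def contractStep (ψ : W ⊗[ℂ] W →ₗ[ℂ] W ⊗[ℂ] W) (F : W ⊗[ℂ] W →ₗ[ℂ] ℂ) :
    W →ₗ[ℂ] TensorAlgebra ℂ W × (W →ₗ[ℂ] TensorAlgebra ℂ W) →ₗ[ℂ] (W →ₗ[ℂ] TensorAlgebra ℂ W) :=
  LinearMap.mk₂ ℂ
    (fun y p => (LinearMap.toSpanSingleton ℂ (TensorAlgebra ℂ W) p.1 ∘ₗ F -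
        LinearMap.mul' ℂ (TensorAlgebra ℂ W) ∘ₗ
          TensorProduct.map (TensorAlgebra.ι ℂ) p.2 ∘ₗ ψ) ∘ₗ (TensorProduct.mk ℂ W W).flip y)
    (fun y y' p => by ext x; simp [add_smul]; abel)
    (fun c y p => by ext x; simp [smul_sub])
    (fun y p q => by ext x; simp [TensorProduct.map_add_right]; abel)
    (fun c y p => by
      ext x
      simp [TensorProduct.map_smul_right, smul_sub, smul_comm c])

/-- The contraction on the tensor algebra, `contract ψ F t x = ι^F_x(t)`. It is the solution of
the braided Leibniz rule: `ι_x(1) = 0` and `ι_x(y t) = F(x, y) t - ∑ y_k ι_{x_k}(t)`, where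
`ψ(x ⊗ y) = ∑ y_k ⊗ x_k`. -/
def contract (ψ : W ⊗[ℂ] W →ₗ[ℂ] W ⊗[ℂ] W) (F : W ⊗[ℂ] W →ₗ[ℂ] ℂ) :
    TensorAlgebra ℂ W →ₗ[ℂ] W →ₗ[ℂ] TensorAlgebra ℂ W :=
  leftRec 0 (contractStep ψ F)

@[simp] theorem contract_one (ψ : W ⊗[ℂ] W →ₗ[ℂ] W ⊗[ℂ] W) (F : W ⊗[ℂ] W →ₗ[ℂ] ℂ) :
    contract ψ F 1 = 0 := by simp [contract]

theorem contract_cons (ψ : W ⊗[ℂ] W →ₗ[ℂ] W ⊗[ℂ] W) (F : W ⊗[ℂ] W →ₗ[ℂ] ℂ) (x y : W)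
    (t : TensorAlgebra ℂ W) :
    contract ψ F (TensorAlgebra.ι ℂ y * t) x = F (x ⊗ₜ y) • t -
      LinearMap.mul' ℂ (TensorAlgebra ℂ W)
        (TensorProduct.map (TensorAlgebra.ι ℂ) (contract ψ F t) (ψ (x ⊗ₜ y))) := by
  simp [contract, contractStep]

/-- Chevalley's map `λ_F : T(W) → T(W)`, `λ_F(1) = 1`, `λ_F(x t) = x λ_F(t) + ι^F_x(λ_F(t))`. -/
def chevalley (ψ : W ⊗[ℂ] W →ₗ[ℂ] W ⊗[ℂ] W) (F : W ⊗[ℂ] W →ₗ[ℂ] ℂ) :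
    TensorAlgebra ℂ W →ₗ[ℂ] TensorAlgebra ℂ W :=
  LinearMap.applyₗ (1 : TensorAlgebra ℂ W) ∘ₗ
    (TensorAlgebra.lift ℂ
      ((LinearMap.mul ℂ (TensorAlgebra ℂ W) ∘ₗ TensorAlgebra.ι ℂ + (contract ψ F).flip :
        W →ₗ[ℂ] Module.End ℂ (TensorAlgebra ℂ W)))).toLinearMap

@[simp] theorem chevalley_one (ψ : W ⊗[ℂ] W →ₗ[ℂ] W ⊗[ℂ] W) (F : W ⊗[ℂ] W →ₗ[ℂ] ℂ) :
    chevalley ψ F 1 = 1 := by simp [chevalley]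

theorem chevalley_cons (ψ : W ⊗[ℂ] W →ₗ[ℂ] W ⊗[ℂ] W) (F : W ⊗[ℂ] W →ₗ[ℂ] ℂ) (x : W)
    (t : TensorAlgebra ℂ W) :
    chevalley ψ F (TensorAlgebra.ι ℂ x * t) =
      TensorAlgebra.ι ℂ x * chevalley ψ F t + contract ψ F (chevalley ψ F t) x := by
  simp [chevalley]

/-- The relations `t = 0` for `t ∈ λ_F⁻¹(ker A)`. -/
inductive Rel (ψ : W ⊗[ℂ] W →ₗ[ℂ] W ⊗[ℂ] W) (F : W ⊗[ℂ] W →ₗ[ℂ] ℂ) :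
    TensorAlgebra ℂ W → TensorAlgebra ℂ W → Prop
  | of (t : TensorAlgebra ℂ W) (h : antisym ψ (chevalley ψ F t) = 0) : Rel ψ F t 0

/-- The braided Clifford algebra `cl(W, ψ, F) = T(W) / J_F` with `J_F = λ_F⁻¹(ker A)`. (`RingQuot`
divides by the two-sided ideal generated by this subspace; the subspace is itself a two-sided ideal
when `ψ` is a braid and `F` is compatible with `ψ`.) -/
abbrev Cl (ψ : W ⊗[ℂ] W →ₗ[ℂ] W ⊗[ℂ] W) (F : W ⊗[ℂ] W →ₗ[ℂ] ℂ) : Type u :=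
  RingQuot (Rel ψ F)

/-- The canonical map `W → cl(W, ψ, F)`. -/
def gen (ψ : W ⊗[ℂ] W →ₗ[ℂ] W ⊗[ℂ] W) (F : W ⊗[ℂ] W →ₗ[ℂ] ℂ) : W →ₗ[ℂ] Cl ψ F :=
  (RingQuot.mkAlgHom ℂ (Rel ψ F)).toLinearMap ∘ₗ TensorAlgebra.ι ℂ

end TensorAlg

section Functoriality

variable {W V : Type u} [AddCommGroup W] [Module ℂ W] [AddCommGroup V] [Module ℂ V]
  {ψ : W ⊗[ℂ] W →ₗ[ℂ] W ⊗[ℂ] W} {F : W ⊗[ℂ] W →ₗ[ℂ] ℂ}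
  {Ψ : V ⊗[ℂ] V →ₗ[ℂ] V ⊗[ℂ] V} {E : V ⊗[ℂ] V →ₗ[ℂ] ℂ} (f : W →ₗ[ℂ] V)

/-- The extension of a linear map to tensor algebras. -/
def tmap : TensorAlgebra ℂ W →ₐ[ℂ] TensorAlgebra ℂ V :=
  TensorAlgebra.lift ℂ (TensorAlgebra.ι ℂ ∘ₗ f)

@[simp] theorem tmap_ι (x : W) : tmap f (TensorAlgebra.ι ℂ x) = TensorAlgebra.ι ℂ (f x) := by
  simp [tmap]

theorem uncons_tmap (t : TensorAlgebra ℂ W) :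
    uncons V (tmap f t) = TensorProduct.map f (tmap f).toLinearMap (uncons W t) := by
  induction t using left_induction with
  | h1 => simp
  | hc x t _ => simp
  | hs c t h => simp [h]
  | ha s t hs ht => simp [hs, ht]

theorem cons_map (z : W ⊗[ℂ] TensorAlgebra ℂ W) :
    cons V (TensorProduct.map f (tmap f).toLinearMap z) = tmap f (cons W z) := by
  induction z with
  | zero => simp
  | tmul x t => simp
  | add a b ha hb => simp [ha, hb]

theorem twist_tmap (hψ : TensorProduct.map f f ∘ₗ ψ = Ψ ∘ₗ TensorProduct.map f f) (i : ℕ)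
    (t : TensorAlgebra ℂ W) : twist Ψ i (tmap f t) = tmap f (twist ψ i t) := by
  induction i generalizing t with
  | zero =>
    have h1 : ∀ z : W ⊗[ℂ] TensorAlgebra ℂ W,
        (uncons V).lTensor V (TensorProduct.map f (tmap f).toLinearMap z) =
          TensorProduct.map f (TensorProduct.map f (tmap f).toLinearMap)
            ((uncons W).lTensor W z) := by
      intro z
      induction z with
      | zero => simp
      | tmul x t => simp [uncons_tmap]
      | add a b ha hb => simp [ha, hb]
    have h2 : ∀ z : W ⊗[ℂ] (W ⊗[ℂ] TensorAlgebra ℂ W),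
        (TensorProduct.assoc ℂ V V (TensorAlgebra ℂ V)).symm
          (TensorProduct.map f (TensorProduct.map f (tmap f).toLinearMap) z) =
          TensorProduct.map (TensorProduct.map f f) (tmap f).toLinearMap
            ((TensorProduct.assoc ℂ W W (TensorAlgebra ℂ W)).symm z) := by
      intro z
      rw [LinearEquiv.symm_apply_eq, ← TensorProduct.map_map_assoc]
      simp
    have h3 : ∀ z : (W ⊗[ℂ] W) ⊗[ℂ] TensorAlgebra ℂ W,
        Ψ.rTensor (TensorAlgebra ℂ V)
          (TensorProduct.map (TensorProduct.map f f) (tmap f).toLinearMap z) =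
          TensorProduct.map (TensorProduct.map f f) (tmap f).toLinearMap
            (ψ.rTensor (TensorAlgebra ℂ W) z) := by
      intro z
      induction z with
      | zero => simp
      | tmul x t =>
        have := LinearMap.congr_fun hψ x
        simp only [LinearMap.comp_apply] at this
        simp [this]
      | add a b ha hb => simp only [map_add, ha, hb]
    have h4 : ∀ z : W ⊗[ℂ] (W ⊗[ℂ] TensorAlgebra ℂ W),
        (cons V).lTensor V (TensorProduct.map f (TensorProduct.map f (tmap f).toLinearMap) z) =
          TensorProduct.map f (tmap f).toLinearMap ((cons W).lTensor W z) := by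
      intro z
      induction z with
      | zero => simp
      | tmul x t => simp [cons_map]
      | add a b ha hb => simp [ha, hb]
    simp only [twist, LinearMap.comp_apply, LinearEquiv.coe_coe]
    rw [uncons_tmap, h1, h2, h3, ← TensorProduct.map_map_assoc, h4, cons_map]
  | succ i ih =>
    have h1 : ∀ z : W ⊗[ℂ] TensorAlgebra ℂ W,
        (twist Ψ i).lTensor V (TensorProduct.map f (tmap f).toLinearMap z) =
          TensorProduct.map f (tmap f).toLinearMap ((twist ψ i).lTensor W z) := by
      intro z
      induction z with
      | zero => simp
      | tmul x t => simp [ih]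
      | add a b ha hb => simp [ha, hb]
    simp only [twist, LinearMap.comp_apply]
    rw [uncons_tmap, h1, cons_map]

theorem wordOp_tmap (hψ : TensorProduct.map f f ∘ₗ ψ = Ψ ∘ₗ TensorProduct.map f f) {n : ℕ}
    (l : List (Fin n)) (t : TensorAlgebra ℂ W) :
    wordOp Ψ l (tmap f t) = tmap f (wordOp ψ l t) := by
  induction l with
  | nil => simp [wordOp]
  | cons i l ih =>
    simp only [wordOp, List.map_cons, List.prod_cons, Module.End.mul_apply] at ih ⊢
    rw [ih, twist_tmap f hψ]

theorem antisymDeg_tmap (hψ : TensorProduct.map f f ∘ₗ ψ = Ψ ∘ₗ TensorProduct.map f f) (n : ℕ)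
    (t : TensorAlgebra ℂ W) : antisymDeg Ψ n (tmap f t) = tmap f (antisymDeg ψ n t) := by
  cases n with
  | zero => simp [antisymDeg]
  | succ n => simp [antisymDeg, LinearMap.sum_apply, wordOp_tmap f hψ]

theorem antisym_of_mem (ψ : W ⊗[ℂ] W →ₗ[ℂ] W ⊗[ℂ] W) {n : ℕ} {t : TensorAlgebra ℂ W}
    (ht : t ∈ (LinearMap.range (TensorAlgebra.ι ℂ : W →ₗ[ℂ] TensorAlgebra ℂ W)) ^ n) :
    antisym ψ t = antisymDeg ψ n t := by
  lift t to ↥((LinearMap.range (TensorAlgebra.ι ℂ : W →ₗ[ℂ] TensorAlgebra ℂ W)) ^ n) using ht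
  simp only [antisym, LinearMap.comp_apply, LinearEquiv.coe_coe,
    DirectSum.decomposeLinearEquiv_apply, DirectSum.decompose_coe]
  rw [← DirectSum.lof_eq_of ℂ, DirectSum.toModule_lof]
  simp

theorem tmap_mem {n : ℕ} {t : TensorAlgebra ℂ W}
    (ht : t ∈ (LinearMap.range (TensorAlgebra.ι ℂ : W →ₗ[ℂ] TensorAlgebra ℂ W)) ^ n) :
    tmap f t ∈ (LinearMap.range (TensorAlgebra.ι ℂ : V →ₗ[ℂ] TensorAlgebra ℂ V)) ^ n := by
  have h := Submodule.mem_map_of_mem (f := (tmap f).toLinearMap) ht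
  rw [Submodule.map_pow] at h
  have hle : Submodule.map (tmap f).toLinearMap
      (LinearMap.range (TensorAlgebra.ι ℂ : W →ₗ[ℂ] TensorAlgebra ℂ W)) ≤
      LinearMap.range (TensorAlgebra.ι ℂ : V →ₗ[ℂ] TensorAlgebra ℂ V) := by
    rintro _ ⟨_, ⟨x, rfl⟩, rfl⟩
    exact ⟨f x, by simp⟩
  exact pow_le_pow_left' hle n h

theorem antisym_tmap (hψ : TensorProduct.map f f ∘ₗ ψ = Ψ ∘ₗ TensorProduct.map f f)
    (t : TensorAlgebra ℂ W) : antisym Ψ (tmap f t) = tmap f (antisym ψ t) := by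
  induction t using DirectSum.Decomposition.inductionOn
    (fun n : ℕ => (LinearMap.range (TensorAlgebra.ι ℂ : W →ₗ[ℂ] TensorAlgebra ℂ W)) ^ n) with
  | zero => simp
  | homogeneous t =>
    rw [antisym_of_mem ψ t.2, antisym_of_mem Ψ (tmap_mem f t.2), antisymDeg_tmap f hψ]
  | add a b ha hb => simp [ha, hb]

theorem contract_tmap (hψ : TensorProduct.map f f ∘ₗ ψ = Ψ ∘ₗ TensorProduct.map f f)
    (hF : E ∘ₗ TensorProduct.map f f = F) (t : TensorAlgebra ℂ W) :
    ∀ x, contract Ψ E (tmap f t) (f x) = tmap f (contract ψ F t x) := by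
  induction t using left_induction with
  | h1 => simp
  | hc y t ih =>
    intro x
    have h0 : E (f x ⊗ₜ f y) = F (x ⊗ₜ y) := by rw [← hF]; simp
    have h1 : Ψ (f x ⊗ₜ f y) = TensorProduct.map f f (ψ (x ⊗ₜ y)) := by
      have := LinearMap.congr_fun hψ (x ⊗ₜ y)
      simpa using this.symm
    have h2 : ∀ z : W ⊗[ℂ] W, LinearMap.mul' ℂ (TensorAlgebra ℂ V)
        (TensorProduct.map (TensorAlgebra.ι ℂ) (contract Ψ E (tmap f t))
          (TensorProduct.map f f z)) =
        tmap f (LinearMap.mul' ℂ (TensorAlgebra ℂ W)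
          (TensorProduct.map (TensorAlgebra.ι ℂ) (contract ψ F t) z)) := by
      intro z
      induction z with
      | zero => simp
      | tmul a b => simp [ih]
      | add a b ha hb => simp only [map_add, ha, hb]
    rw [map_mul, tmap_ι, contract_cons, contract_cons, h0, h1, h2]
    simp
  | hs c t h => simp [h]
  | ha s t hs ht => simp [hs, ht]

theorem chevalley_tmap (hψ : TensorProduct.map f f ∘ₗ ψ = Ψ ∘ₗ TensorProduct.map f f)
    (hF : E ∘ₗ TensorProduct.map f f = F) (t : TensorAlgebra ℂ W) :
    chevalley Ψ E (tmap f t) = tmap f (chevalley ψ F t) := by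
  induction t using left_induction with
  | h1 => simp
  | hc x t ih =>
    rw [map_mul, tmap_ι, chevalley_cons, chevalley_cons, ih, contract_tmap f hψ hF]
    simp
  | hs c t h => simp [h]
  | ha s t hs ht => simp [hs, ht]

/-- The algebra map of braided Clifford algebras extending a linear map `f : W → V` that
intertwines the braids and the forms. -/
def Cl.map (hψ : TensorProduct.map f f ∘ₗ ψ = Ψ ∘ₗ TensorProduct.map f f)
    (hF : E ∘ₗ TensorProduct.map f f = F) : Cl ψ F →ₐ[ℂ] Cl Ψ E :=
  RingQuot.liftAlgHom ℂ ⟨(RingQuot.mkAlgHom ℂ (Rel Ψ E)).comp (tmap f), by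
    intro a b hab
    obtain ⟨t, ht, rfl, rfl⟩ : ∃ t, antisym ψ (chevalley ψ F t) = 0 ∧ t = a ∧ 0 = b := by
      induction hab with
      | of h => exact ⟨_, h, rfl, rfl⟩
    have h' : Rel Ψ E (tmap f t) 0 := by
      refine Rel.of _ ?_
      rw [chevalley_tmap f hψ hF, antisym_tmap f hψ, ht, map_zero]
    simpa using RingQuot.mkAlgHom_rel ℂ h'⟩

theorem Cl.map_gen (hψ : TensorProduct.map f f ∘ₗ ψ = Ψ ∘ₗ TensorProduct.map f f)
    (hF : E ∘ₗ TensorProduct.map f f = F) (x : W) :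
    Cl.map f hψ hF (gen ψ F x) = gen Ψ E (f x) := by
  simp [Cl.map, gen]

end Functoriality

section Double

variable {W : Type u} [AddCommGroup W] [Module ℂ W]

/-- The braid `Ψ` on `W ⊕ W`: the mixed and the unmixed summands `W_i ⊗ W_j` are mapped to
`W_j ⊗ W_i` by `ψ`. -/
def doubleBraid (ψ : W ⊗[ℂ] W →ₗ[ℂ] W ⊗[ℂ] W) :
    (W × W) ⊗[ℂ] (W × W) →ₗ[ℂ] (W × W) ⊗[ℂ] (W × W) :=
  TensorProduct.map (LinearMap.inl ℂ W W) (LinearMap.inl ℂ W W) ∘ₗ ψ ∘ₗ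
      TensorProduct.map (LinearMap.fst ℂ W W) (LinearMap.fst ℂ W W) +
    TensorProduct.map (LinearMap.inr ℂ W W) (LinearMap.inl ℂ W W) ∘ₗ ψ ∘ₗ
      TensorProduct.map (LinearMap.fst ℂ W W) (LinearMap.snd ℂ W W) +
    TensorProduct.map (LinearMap.inl ℂ W W) (LinearMap.inr ℂ W W) ∘ₗ ψ ∘ₗ
      TensorProduct.map (LinearMap.snd ℂ W W) (LinearMap.fst ℂ W W) +
    TensorProduct.map (LinearMap.inr ℂ W W) (LinearMap.inr ℂ W W) ∘ₗ ψ ∘ₗ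
      TensorProduct.map (LinearMap.snd ℂ W W) (LinearMap.snd ℂ W W)

/-- The form `E` on `W ⊕ W`: `F` on the two unmixed summands, `-F/2` on the two mixed ones. -/
def doubleForm (F : W ⊗[ℂ] W →ₗ[ℂ] ℂ) : (W × W) ⊗[ℂ] (W × W) →ₗ[ℂ] ℂ :=
  F ∘ₗ TensorProduct.map (LinearMap.fst ℂ W W) (LinearMap.fst ℂ W W) +
    F ∘ₗ TensorProduct.map (LinearMap.snd ℂ W W) (LinearMap.snd ℂ W W) -
    (1 / 2 : ℂ) • F ∘ₗ TensorProduct.map (LinearMap.fst ℂ W W) (LinearMap.snd ℂ W W) -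
    (1 / 2 : ℂ) • F ∘ₗ TensorProduct.map (LinearMap.snd ℂ W W) (LinearMap.fst ℂ W W)

/-- The diagonal map `Δ : W → W ⊕ W`. -/
def diag (W : Type u) [AddCommGroup W] [Module ℂ W] : W →ₗ[ℂ] W × W :=
  LinearMap.id.prod LinearMap.id

theorem inl_braid (ψ : W ⊗[ℂ] W →ₗ[ℂ] W ⊗[ℂ] W) :
    TensorProduct.map (LinearMap.inl ℂ W W) (LinearMap.inl ℂ W W) ∘ₗ ψ =
      doubleBraid ψ ∘ₗ TensorProduct.map (LinearMap.inl ℂ W W) (LinearMap.inl ℂ W W) := by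
  ext x y
  all_goals simp [doubleBraid]

theorem inr_braid (ψ : W ⊗[ℂ] W →ₗ[ℂ] W ⊗[ℂ] W) :
    TensorProduct.map (LinearMap.inr ℂ W W) (LinearMap.inr ℂ W W) ∘ₗ ψ =
      doubleBraid ψ ∘ₗ TensorProduct.map (LinearMap.inr ℂ W W) (LinearMap.inr ℂ W W) := by
  ext x y
  all_goals simp [doubleBraid]

theorem diag_braid (ψ : W ⊗[ℂ] W →ₗ[ℂ] W ⊗[ℂ] W) :
    TensorProduct.map (diag W) (diag W) ∘ₗ ψ =
      doubleBraid ψ ∘ₗ TensorProduct.map (diag W) (diag W) := by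
  have hd : diag W = LinearMap.inl ℂ W W + LinearMap.inr ℂ W W := by
    ext x <;> simp [diag]
  ext x y
  simp only [TensorProduct.AlgebraTensorModule.curry_apply, TensorProduct.curry_apply,
    LinearMap.coe_restrictScalars, LinearMap.comp_apply, TensorProduct.map_tmul]
  simp [doubleBraid, diag]
  rw [← diag, hd]
  simp only [TensorProduct.map_add_left, TensorProduct.map_add_right, LinearMap.add_apply]
  abel

theorem inl_form (F : W ⊗[ℂ] W →ₗ[ℂ] ℂ) :
    doubleForm F ∘ₗ TensorProduct.map (LinearMap.inl ℂ W W) (LinearMap.inl ℂ W W) = F := by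
  ext x y
  simp [doubleForm]

theorem inr_form (F : W ⊗[ℂ] W →ₗ[ℂ] ℂ) :
    doubleForm F ∘ₗ TensorProduct.map (LinearMap.inr ℂ W W) (LinearMap.inr ℂ W W) = F := by
  ext x y
  simp [doubleForm]

theorem diag_form (F : W ⊗[ℂ] W →ₗ[ℂ] ℂ) :
    doubleForm F ∘ₗ TensorProduct.map (diag W) (diag W) = F := by
  ext x y
  simp [doubleForm, diag]
  ring

variable (ψ : W ⊗[ℂ] W →ₗ[ℂ] W ⊗[ℂ] W) (F : W ⊗[ℂ] W →ₗ[ℂ] ℂ)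

/-- The algebra map `ℓ₋ : cl(W, ψ, F) → cl(W ⊕ W, Ψ, E)` with `ℓ₋(x) = (x, 0)`. -/
def ellMinus : Cl ψ F →ₐ[ℂ] Cl (doubleBraid ψ) (doubleForm F) :=
  Cl.map (LinearMap.inl ℂ W W) (inl_braid ψ) (inl_form F)

/-- The algebra map `ℓ₊ : cl(W, ψ, F) → cl(W ⊕ W, Ψ, E)` with `ℓ₊(x) = (0, x)`. -/
def ellPlus : Cl ψ F →ₐ[ℂ] Cl (doubleBraid ψ) (doubleForm F) :=
  Cl.map (LinearMap.inr ℂ W W) (inr_braid ψ) (inr_form F)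

/-- The algebra map `Δ* : cl(W, ψ, F) → cl(W ⊕ W, Ψ, E)` with `Δ*(x) = (x, x)`. -/
def diagStar : Cl ψ F →ₐ[ℂ] Cl (doubleBraid ψ) (doubleForm F) :=
  Cl.map (diag W) (diag_braid ψ) (diag_form F)

/-- The linear map `ℓ_F(a ⊗ b) = ℓ₋(a) ℓ₊(b)`. -/
def ellF : Cl ψ F ⊗[ℂ] Cl ψ F →ₗ[ℂ] Cl (doubleBraid ψ) (doubleForm F) :=
  LinearMap.mul' ℂ (Cl (doubleBraid ψ) (doubleForm F)) ∘ₗ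
    TensorProduct.map (ellMinus ψ F).toLinearMap (ellPlus ψ F).toLinearMap

end Double

section Flip

variable {W : Type u} [AddCommGroup W] [Module ℂ W]

/-- `σ` is the flip-over operator `σ_F` of `𝒜 = cl(W, ψ, F)`. -/
structure IsFlip (ψ : W ⊗[ℂ] W →ₗ[ℂ] W ⊗[ℂ] W) (F : W ⊗[ℂ] W →ₗ[ℂ] ℂ)
    (σ : Cl ψ F ⊗[ℂ] Cl ψ F →ₗ[ℂ] Cl ψ F ⊗[ℂ] Cl ψ F) : Prop where
  /-- `(m ⊗ id)(id ⊗ σ)(σ ⊗ id) = σ(id ⊗ m)` -/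
  mul_right : (LinearMap.mul' ℂ (Cl ψ F)).rTensor (Cl ψ F) ∘ₗ onRight σ ∘ₗ onLeft σ =
    σ ∘ₗ (LinearMap.mul' ℂ (Cl ψ F)).lTensor (Cl ψ F) ∘ₗ
      (TensorProduct.assoc ℂ (Cl ψ F) (Cl ψ F) (Cl ψ F)).toLinearMap
  /-- `(id ⊗ m)(σ ⊗ id)(id ⊗ σ) = σ(m ⊗ id)` -/
  mul_left : (LinearMap.mul' ℂ (Cl ψ F)).lTensor (Cl ψ F) ∘ₗ
      (TensorProduct.assoc ℂ (Cl ψ F) (Cl ψ F) (Cl ψ F)).toLinearMap ∘ₗ onLeft σ ∘ₗ onRight σ =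
    σ ∘ₗ (LinearMap.mul' ℂ (Cl ψ F)).rTensor (Cl ψ F)
  one_left : ∀ a : Cl ψ F, σ (1 ⊗ₜ a) = a ⊗ₜ 1
  one_right : ∀ a : Cl ψ F, σ (a ⊗ₜ 1) = 1 ⊗ₜ a
  /-- `σ(x ⊗ y) = -ψ(x ⊗ y) - F(x, y) 1 ⊗ 1` -/
  gen_gen : ∀ x y : W, σ (gen ψ F x ⊗ₜ gen ψ F y) =
    -TensorProduct.map (gen ψ F) (gen ψ F) (ψ (x ⊗ₜ y)) - F (x ⊗ₜ y) • (1 ⊗ₜ 1)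

/-- The product `(a ⊗ b)(c ⊗ d) = a σ(b ⊗ c) d` of `A ⊗ A` induced by `σ`, that is
`(m ⊗ m)(id ⊗ σ ⊗ id)`. -/
def flipMul {A : Type u} [Ring A] [Algebra ℂ A] (σ : A ⊗[ℂ] A →ₗ[ℂ] A ⊗[ℂ] A)
    (p q : A ⊗[ℂ] A) : A ⊗[ℂ] A :=
  (TensorProduct.map (LinearMap.mul' ℂ A) (LinearMap.mul' ℂ A) ∘ₗ
    (TensorProduct.assoc ℂ A A (A ⊗[ℂ] A)).symm.toLinearMap ∘ₗ
    ((TensorProduct.assoc ℂ A A A).toLinearMap ∘ₗ σ.rTensor A ∘ₗ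
      (TensorProduct.assoc ℂ A A A).symm.toLinearMap).lTensor A ∘ₗ
    (TensorProduct.assoc ℂ A A (A ⊗[ℂ] A)).toLinearMap) (p ⊗ₜ[ℂ] q)

/-- `φ` is the coproduct: the unital homomorphism from `𝒜` to `𝒜 ⊗ 𝒜` (with the product induced
by `σ`) such that `φ(x) = 1 ⊗ x + x ⊗ 1` for `x ∈ W`. -/
structure IsCoproduct (ψ : W ⊗[ℂ] W →ₗ[ℂ] W ⊗[ℂ] W) (F : W ⊗[ℂ] W →ₗ[ℂ] ℂ)
    (σ : Cl ψ F ⊗[ℂ] Cl ψ F →ₗ[ℂ] Cl ψ F ⊗[ℂ] Cl ψ F)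
    (φ : Cl ψ F →ₗ[ℂ] Cl ψ F ⊗[ℂ] Cl ψ F) : Prop where
  map_one : φ 1 = 1 ⊗ₜ 1
  map_mul : ∀ a b : Cl ψ F, φ (a * b) = flipMul σ (φ a) (φ b)
  map_gen : ∀ x : W, φ (gen ψ F x) = 1 ⊗ₜ gen ψ F x + gen ψ F x ⊗ₜ 1

end Flip

end BraidedCliff

end

open BraidedCliff

/-!
Modulo the quadratic elements `x y + ∑ y_k x_k` every twist is the multiplication by `-1`, so `ψ_π`
is the multiplication by the sign of `π` and `A_n` the multiplication by `n!`. Hence `ker A` lies in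
the ideal generated by these elements (`map_eq_zero_of_antisym`), and since `ψ² = id` it contains
them (`antisym_tensorMul`). Chevalley's map transports this to `J_F`: on the algebra with the
relations `x y + ∑ y_k x_k = 2 F(x, y)` the operators `x - ι_x` satisfy the homogeneous relations,
and they invert `λ_F` (`IsPresentation.map_eq_zero`). So `cl(W, ψ, F)` is presented by the
quadratic Clifford relations (`isPresentation_cl`), and the same holds for `cl(W ⊕ W, Ψ, E)`,
because `(Ψ, E)` satisfies the same hypotheses as `(ψ, F)` (`BraidData.double`).

In `cl(W ⊕ W, Ψ, E)` the mixed relation is `ℓ₊(x) ℓ₋(y) = -∑ ℓ₋(y_k) ℓ₊(x_k) - F(x, y)`. It lets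
every element be written with the first copy of `W` on the left, so `ℓ_F` is surjective. For the
injectivity, `cl(W ⊕ W, Ψ, E)` acts on `𝒜 ⊗ 𝒜` by the formulas the product has to have
(`exists_double_action`), and the action on `1 ⊗ 1` inverts `ℓ_F`. Everything else is transport
along the bijection `ℓ_F`: a flip-over operator is the same as a solution of
`ℓ_F(σ(a ⊗ b)) = ℓ₊(a) ℓ₋(b)`, the product induced by `σ` is the product of `cl(W ⊕ W, Ψ, E)`, and
the coproduct is `Δ*`.

All recursions over products go through one computation with `W ⊗ W ⊗ W`, in which a vector is
moved past a quadratic relation (`IsClifford.crossStep`), and its mirror image, in which a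
quadratic relation is moved past a vector (`clifford_of_cross`).
-/

namespace BraidedCliff

universe u

/-! ### Quadratic Clifford relations -/

section Clifford

variable {W B : Type*} [AddCommGroup W] [Module ℂ W] [Ring B] [Algebra ℂ B]

/-- The linear map `x ⊗ y ↦ f(x) g(y)`, for linear maps `f`, `g` into an algebra. -/
noncomputable def tensorMul (f g : W →ₗ[ℂ] B) : W ⊗[ℂ] W →ₗ[ℂ] B :=
  LinearMap.mul' ℂ B ∘ₗ TensorProduct.map f g

@[simp] theorem tensorMul_tmul (f g : W →ₗ[ℂ] B) (x y : W) :
    tensorMul f g (x ⊗ₜ y) = f x * g y := by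
  simp [tensorMul]

theorem algHom_tensorMul {B' : Type*} [Ring B'] [Algebra ℂ B'] (φ : B →ₐ[ℂ] B')
    (f g : W →ₗ[ℂ] B) (z : W ⊗[ℂ] W) :
    φ (tensorMul f g z) = tensorMul (φ.toLinearMap ∘ₗ f) (φ.toLinearMap ∘ₗ g) z := by
  induction z with
  | zero => simp
  | tmul x y => simp
  | add a b ha hb => simp [ha, hb]

/-- `f : W → B` satisfies the quadratic relations `f(x) f(y) + ∑ f(y_k) f(x_k) = 2 F(x, y)` of the
braided Clifford algebra, where `ψ(x ⊗ y) = ∑ y_k ⊗ x_k`. -/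
def IsClifford (ψ : W ⊗[ℂ] W →ₗ[ℂ] W ⊗[ℂ] W) (F : W ⊗[ℂ] W →ₗ[ℂ] ℂ) (f : W →ₗ[ℂ] B) : Prop :=
  ∀ z, tensorMul f f z + tensorMul f f (ψ z) = (2 * F z) • (1 : B)

theorem IsClifford.map {B' : Type*} [Ring B'] [Algebra ℂ B']
    {ψ : W ⊗[ℂ] W →ₗ[ℂ] W ⊗[ℂ] W} {F : W ⊗[ℂ] W →ₗ[ℂ] ℂ} {f : W →ₗ[ℂ] B}
    (hf : IsClifford ψ F f) (φ : B →ₐ[ℂ] B') : IsClifford ψ F (φ.toLinearMap ∘ₗ f) := by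
  intro z
  rw [← algHom_tensorMul, ← algHom_tensorMul, ← map_add, hf z]
  simp

end Clifford

/-! ### Braids and forms on threefold tensor products -/

section Triple

variable {W : Type*} [AddCommGroup W] [Module ℂ W]

/-- `G ⊗ id : W ⊗ W ⊗ W → W`. -/
noncomputable def formLeft (G : W ⊗[ℂ] W →ₗ[ℂ] ℂ) : (W ⊗[ℂ] W) ⊗[ℂ] W →ₗ[ℂ] W :=
  (TensorProduct.lid ℂ W).toLinearMap ∘ₗ G.rTensor W

/-- `id ⊗ G : W ⊗ W ⊗ W → W`. -/
noncomputable def formRight (G : W ⊗[ℂ] W →ₗ[ℂ] ℂ) : (W ⊗[ℂ] W) ⊗[ℂ] W →ₗ[ℂ] W :=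
  (TensorProduct.rid ℂ W).toLinearMap ∘ₗ G.lTensor W ∘ₗ (TensorProduct.assoc ℂ W W W).toLinearMap

@[simp] theorem formLeft_tmul (G : W ⊗[ℂ] W →ₗ[ℂ] ℂ) (z : W ⊗[ℂ] W) (x : W) :
    formLeft G (z ⊗ₜ x) = G z • x := by
  simp [formLeft]

@[simp] theorem formRight_tmul (G : W ⊗[ℂ] W →ₗ[ℂ] ℂ) (x y z : W) :
    formRight G ((x ⊗ₜ y) ⊗ₜ z) = G (y ⊗ₜ z) • x := by
  simp [formRight]

@[simp] theorem formRight_assoc_symm (G : W ⊗[ℂ] W →ₗ[ℂ] ℂ) (x : W) (z : W ⊗[ℂ] W) :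
    formRight G ((TensorProduct.assoc ℂ W W W).symm (x ⊗ₜ z)) = G z • x := by
  simp [formRight]

@[simp] theorem onLeft_tmul (ψ : W ⊗[ℂ] W →ₗ[ℂ] W ⊗[ℂ] W) (z : W ⊗[ℂ] W) (x : W) :
    onLeft ψ (z ⊗ₜ x) = ψ z ⊗ₜ x := by
  simp [onLeft]

@[simp] theorem onRight_assoc_symm (ψ : W ⊗[ℂ] W →ₗ[ℂ] W ⊗[ℂ] W) (x : W) (z : W ⊗[ℂ] W) :
    onRight ψ ((TensorProduct.assoc ℂ W W W).symm (x ⊗ₜ z)) =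
      (TensorProduct.assoc ℂ W W W).symm (x ⊗ₜ ψ z) := by
  simp [onRight]

@[simp] theorem onRight_tmul (ψ : W ⊗[ℂ] W →ₗ[ℂ] W ⊗[ℂ] W) (x y z : W) :
    onRight ψ ((x ⊗ₜ y) ⊗ₜ z) = (TensorProduct.assoc ℂ W W W).symm (x ⊗ₜ ψ (y ⊗ₜ z)) := by
  simp [onRight]

theorem formLeft_smul (c : ℂ) (G : W ⊗[ℂ] W →ₗ[ℂ] ℂ) (w : (W ⊗[ℂ] W) ⊗[ℂ] W) :
    formLeft (c • G) w = c • formLeft G w := by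
  simp [formLeft, LinearMap.rTensor_smul]

theorem formRight_smul (c : ℂ) (G : W ⊗[ℂ] W →ₗ[ℂ] ℂ) (w : (W ⊗[ℂ] W) ⊗[ℂ] W) :
    formRight (c • G) w = c • formRight G w := by
  simp [formRight, LinearMap.lTensor_smul]

/-- The data of a braided Clifford algebra: an involutive braid `ψ` and a compatible `ψ`-symmetric
form `F`. -/
structure BraidData (ψ : W ⊗[ℂ] W →ₗ[ℂ] W ⊗[ℂ] W) (F : W ⊗[ℂ] W →ₗ[ℂ] ℂ) : Prop where
  braid : BraidEquation ψ
  inv : ψ ∘ₗ ψ = LinearMap.id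
  cov : CovariantForm ψ F
  symm : F ∘ₗ ψ = F

namespace BraidData

variable {ψ : W ⊗[ℂ] W →ₗ[ℂ] W ⊗[ℂ] W} {F : W ⊗[ℂ] W →ₗ[ℂ] ℂ} (h : BraidData ψ F)
include h

theorem inv_apply (z : W ⊗[ℂ] W) : ψ (ψ z) = z := LinearMap.congr_fun h.inv z

theorem symm_apply (z : W ⊗[ℂ] W) : F (ψ z) = F z := LinearMap.congr_fun h.symm z

theorem braid_apply (w : (W ⊗[ℂ] W) ⊗[ℂ] W) :
    onLeft ψ (onRight ψ (onLeft ψ w)) = onRight ψ (onLeft ψ (onRight ψ w)) :=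
  LinearMap.congr_fun h.braid w

theorem cov_apply (w : (W ⊗[ℂ] W) ⊗[ℂ] W) :
    formLeft F (onRight ψ w) = formRight F (onLeft ψ w) :=
  LinearMap.congr_fun h.cov w

theorem onLeft_onLeft (w : (W ⊗[ℂ] W) ⊗[ℂ] W) : onLeft ψ (onLeft ψ w) = w := by
  rw [onLeft, ← LinearMap.comp_apply, ← LinearMap.rTensor_comp, h.inv]; simp

theorem onRight_onRight (w : (W ⊗[ℂ] W) ⊗[ℂ] W) : onRight ψ (onRight ψ w) = w := by
  simp only [onRight, LinearMap.comp_apply, LinearEquiv.coe_coe, LinearEquiv.apply_symm_apply]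
  rw [← LinearMap.comp_apply (LinearMap.lTensor W ψ), ← LinearMap.lTensor_comp, h.inv]; simp

end BraidData

end Triple

/-! ### Moving vectors past the Clifford relations -/

section Step

variable {W M : Type*} [AddCommGroup W] [Module ℂ W] [AddCommGroup M] [Module ℂ M]

/-- For operators `ρ y` on `M`, the operators
`(m, h) ↦ (ρ y m, x ↦ G(x, y) m - ∑ ρ(y_k) h(x_k))` on `M × Hom(W, M)`, where
`ψ(x ⊗ y) = ∑ y_k ⊗ x_k`. They implement the recursion by which an element `x` is moved past
a product from left to right. -/
noncomputable def crossStep (ψ : W ⊗[ℂ] W →ₗ[ℂ] W ⊗[ℂ] W) (G : W ⊗[ℂ] W →ₗ[ℂ] ℂ)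
    (ρ : W →ₗ[ℂ] Module.End ℂ M) : W →ₗ[ℂ] Module.End ℂ (M × (W →ₗ[ℂ] M)) :=
  LinearMap.mk₂ ℂ
    (fun y p => (ρ y p.1, (LinearMap.toSpanSingleton ℂ M p.1 ∘ₗ G -
        TensorProduct.lift (LinearMap.compl₂ ρ p.2) ∘ₗ ψ) ∘ₗ (TensorProduct.mk ℂ W W).flip y))
    (fun y y' p => by
      ext x
      · simp
      · simp only [LinearMap.comp_apply, LinearMap.flip_apply, TensorProduct.mk_apply,
          map_add, LinearMap.add_apply, Prod.snd_add])
    (fun c y p => by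
      ext x
      · simp
      · simp only [LinearMap.comp_apply, LinearMap.flip_apply, TensorProduct.mk_apply,
          map_smul, LinearMap.smul_apply, Prod.smul_snd])
    (fun y p q => by
      have h : TensorProduct.lift (LinearMap.compl₂ ρ (p.2 + q.2)) =
          TensorProduct.lift (LinearMap.compl₂ ρ p.2) +
            TensorProduct.lift (LinearMap.compl₂ ρ q.2) := by
        ext; simp
      ext x
      · simp
      · simp [h]
        abel)
    (fun c y p => by
      have h : TensorProduct.lift (LinearMap.compl₂ ρ (c • p.2)) =
          c • TensorProduct.lift (LinearMap.compl₂ ρ p.2) := by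
        ext; simp
      ext x
      · simp
      · simp [h, smul_sub, smul_comm c])

variable {ψ : W ⊗[ℂ] W →ₗ[ℂ] W ⊗[ℂ] W} {F : W ⊗[ℂ] W →ₗ[ℂ] ℂ}

@[simp] theorem crossStep_fst (G : W ⊗[ℂ] W →ₗ[ℂ] ℂ) (ρ : W →ₗ[ℂ] Module.End ℂ M) (y : W)
    (p : M × (W →ₗ[ℂ] M)) : (crossStep ψ G ρ y p).1 = ρ y p.1 := rfl

theorem crossStep_snd (G : W ⊗[ℂ] W →ₗ[ℂ] ℂ) (ρ : W →ₗ[ℂ] Module.End ℂ M) (y : W)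
    (p : M × (W →ₗ[ℂ] M)) (x : W) : (crossStep ψ G ρ y p).2 x =
      G (x ⊗ₜ y) • p.1 - TensorProduct.lift (LinearMap.compl₂ ρ p.2) (ψ (x ⊗ₜ y)) := rfl

/-- Moving `x` past `y z`, on `w = x ⊗ y ⊗ z`: the contraction of `x` with `y`, the contraction
with `z` after the twist with `y`, and the passage of `x` to the right end. -/
theorem crossStep_crossStep_snd (G : W ⊗[ℂ] W →ₗ[ℂ] ℂ) (ρ : W →ₗ[ℂ] Module.End ℂ M)
    (m : M) (h : W →ₗ[ℂ] M) (x : W) (z : W ⊗[ℂ] W) :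
    (tensorMul (crossStep ψ G ρ) (crossStep ψ G ρ) z (m, h)).2 x =
      ρ (formLeft G ((TensorProduct.assoc ℂ W W W).symm (x ⊗ₜ z))) m -
      ρ (formRight G (onLeft ψ ((TensorProduct.assoc ℂ W W W).symm (x ⊗ₜ z)))) m +
      TensorProduct.lift (LinearMap.compl₂ (tensorMul ρ ρ) h)
        (onRight ψ (onLeft ψ ((TensorProduct.assoc ℂ W W W).symm (x ⊗ₜ z)))) := by
  induction z with
  | zero => simp
  | add a b ha hb =>
    simp only [TensorProduct.tmul_add, map_add, LinearMap.add_apply, Prod.snd_add, ha, hb]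
    abel
  | tmul y z =>
    rw [tensorMul_tmul, Module.End.mul_apply, crossStep_snd]
    simp only [TensorProduct.assoc_symm_tmul, formLeft_tmul, onLeft_tmul, crossStep_fst,
      map_smul, LinearMap.smul_apply, sub_add]
    congr 1
    induction ψ (x ⊗ₜ[ℂ] y) with
    | zero => simp
    | add a b ha hb =>
      simp only [TensorProduct.add_tmul, map_add, LinearMap.add_apply, ha, hb]
      abel
    | tmul a b =>
      simp only [TensorProduct.lift.tmul, LinearMap.compl₂_apply, crossStep_snd, map_sub,
        map_smul, formRight_tmul, LinearMap.smul_apply, onRight_tmul]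
      congr 1
      induction ψ (b ⊗ₜ[ℂ] z) with
      | zero => simp
      | add a b ha hb => simp only [TensorProduct.tmul_add, map_add, ha, hb]
      | tmul c d => simp

/-- Moving past products respects the Clifford relations. -/
theorem IsClifford.crossStep (hψ : BraidData ψ F) {ρ : W →ₗ[ℂ] Module.End ℂ M}
    (hρ : IsClifford ψ F ρ) (c : ℂ) : IsClifford ψ F (crossStep ψ (c • F) ρ) := by
  intro z
  refine LinearMap.ext fun ⟨m, h⟩ => Prod.ext ?_ (LinearMap.ext fun x => ?_)
  · have h1 : ∀ z, (tensorMul (BraidedCliff.crossStep ψ (c • F) ρ)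
        (BraidedCliff.crossStep ψ (c • F) ρ) z (m, h)).1 = tensorMul ρ ρ z m := by
      intro z
      induction z with
      | zero => simp
      | tmul x y => simp
      | add a b ha hb => simp [ha, hb]
    have := LinearMap.congr_fun (hρ z) m
    simpa [h1] using this
  · simp only [LinearMap.add_apply, Prod.snd_add, crossStep_crossStep_snd, ← onRight_assoc_symm]
    generalize hw : (TensorProduct.assoc ℂ W W W).symm (x ⊗ₜ[ℂ] z) = w
    have h3 : ∀ w, TensorProduct.lift (LinearMap.compl₂ (tensorMul ρ ρ) h) w +
        TensorProduct.lift (LinearMap.compl₂ (tensorMul ρ ρ) h) (onLeft ψ w) =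
          (2 : ℂ) • h (formLeft F w) := by
      intro w
      induction w with
      | zero => simp
      | add a b ha hb => simp only [map_add, smul_add, ← ha, ← hb]; abel
      | tmul u y =>
        have := LinearMap.congr_fun (hρ u) (h y)
        simp only [LinearMap.add_apply] at this
        simp [this, mul_smul]
    have h4 : formRight F w = F z • x := by simp [← hw]
    -- The two contractions cancel by covariance and `ψ² = 1`; the braid equation moves the
    -- relation to the first two factors, where `h3` applies.
    have h5 := h3 (onRight ψ (onLeft ψ w))
    rw [hψ.cov_apply, hψ.onLeft_onLeft, h4, hψ.braid_apply] at h5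
    simp only [formLeft_smul, formRight_smul, ← hψ.cov_apply, hψ.onRight_onRight]
    simp only [map_smul, smul_smul] at h5
    simp only [LinearMap.smul_apply, Module.End.one_apply, Prod.smul_mk, ← h5]
    abel

/-- If `T_x ρ_y = c F(x, y) - ∑ ρ(y_k) T(x_k)`, then the relation
`T_x T_x' + ∑ T(x'_k) T(x_k) = 2 d F(x, x')` passes from a vector `m` to `ρ_y m`. -/
theorem clifford_of_cross (hψ : BraidData ψ F) {ρ T : W →ₗ[ℂ] Module.End ℂ M} (c d : ℂ)
    (hT : ∀ x y, T x * ρ y = (c * F (x ⊗ₜ y)) • 1 - tensorMul ρ T (ψ (x ⊗ₜ y))) (m : M)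
    (hm : ∀ z, tensorMul T T z m + tensorMul T T (ψ z) m = (2 * d * F z) • m) (y : W)
    (z : W ⊗[ℂ] W) :
    tensorMul T T z (ρ y m) + tensorMul T T (ψ z) (ρ y m) = (2 * d * F z) • ρ y m := by
  let P : (W ⊗[ℂ] W) ⊗[ℂ] W →ₗ[ℂ] Module.End ℂ M :=
    LinearMap.mul' ℂ _ ∘ₗ TensorProduct.map ρ (tensorMul T T) ∘ₗ
      (TensorProduct.assoc ℂ W W W).toLinearMap
  have hP : ∀ x u, P ((TensorProduct.assoc ℂ W W W).symm (x ⊗ₜ u)) = ρ x * tensorMul T T u := by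
    intro x u; simp [P]
  have key : ∀ z, tensorMul T T z * ρ y = c • T (formRight F (z ⊗ₜ y)) -
      c • T (formLeft F (onRight ψ (z ⊗ₜ y))) + P (onLeft ψ (onRight ψ (z ⊗ₜ y))) := by
    intro z
    induction z with
    | zero => simp
    | add a b ha hb =>
      simp only [TensorProduct.add_tmul, map_add, add_mul, ha, hb, smul_add]
      abel
    | tmul x x' =>
      rw [tensorMul_tmul, mul_assoc, hT, mul_sub, formRight_tmul, onRight_tmul, sub_add]
      congr 1
      · simp [mul_smul]
      · induction ψ (x' ⊗ₜ[ℂ] y) with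
        | zero => simp
        | add a b ha hb =>
          simp only [TensorProduct.tmul_add, map_add, mul_add, ha, hb, smul_add]
          abel
        | tmul a b =>
          rw [tensorMul_tmul, ← mul_assoc, hT, sub_mul]
          simp only [TensorProduct.assoc_symm_tmul, formLeft_tmul, onLeft_tmul]
          congr 1
          · simp [mul_smul]
          · induction ψ (x ⊗ₜ[ℂ] a) with
            | zero => simp
            | add a b ha hb => simp only [TensorProduct.add_tmul, map_add, add_mul, ha, hb]
            | tmul e f => simp [P, mul_assoc]
  have hR : ∀ w, P w m + P (onRight ψ w) m = (2 * d) • ρ (formRight F w) m := by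
    intro w
    obtain ⟨w, rfl⟩ := (TensorProduct.assoc ℂ W W W).symm.surjective w
    induction w with
    | zero => simp
    | add a b ha hb =>
      simp only [map_add, LinearMap.add_apply, smul_add, ← ha, ← hb]; abel
    | tmul x u =>
      rw [onRight_assoc_symm, hP, hP, formRight_assoc_symm, Module.End.mul_apply,
        Module.End.mul_apply, ← map_add, hm]
      simp [mul_smul]
  -- The contractions of `z` and of `ψ z` cancel by covariance and `ψ² = 1`; the braid equation
  -- moves the relation to the last two factors, where `hR` applies.
  have h1 := LinearMap.congr_fun (key z) m
  have h2 := LinearMap.congr_fun (key (ψ z)) m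
  have h3 := hR (onLeft ψ (onRight ψ (z ⊗ₜ y)))
  rw [← hψ.braid_apply, ← hψ.cov_apply, hψ.onRight_onRight, formLeft_tmul] at h3
  simp only [Module.End.mul_apply] at h1 h2
  rw [h1, h2, ← onLeft_tmul, hψ.cov_apply, hψ.cov_apply, hψ.onLeft_onLeft]
  simp only [map_smul, LinearMap.smul_apply, smul_smul] at h3
  rw [← h3]
  simp only [LinearMap.add_apply, LinearMap.sub_apply]
  abel

end Step

/-! ### Induction in quotients of the tensor algebra -/

section Generation

variable {W : Type u} [AddCommGroup W] [Module ℂ W] {A : Type*} [Ring A] [Algebra ℂ A]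

/-- Left induction in an algebra that is a quotient of the tensor algebra. -/
theorem left_induction_of_surjective {π : TensorAlgebra ℂ W →ₐ[ℂ] A}
    (hπ : Function.Surjective π) {P : A → Prop} (one : P 1)
    (mul : ∀ x a, P a → P (π (TensorAlgebra.ι ℂ x) * a)) (smul : ∀ (c : ℂ) a, P a → P (c • a))
    (add : ∀ a b, P a → P b → P (a + b)) (a : A) : P a := by
  obtain ⟨t, rfl⟩ := hπ a
  induction t using left_induction with
  | h1 => simpa using one
  | hc x t h => simpa using mul x _ h
  | hs c t h => simpa using smul c _ h
  | ha s t hs ht => simpa using add _ _ hs ht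

variable {M : Type*} [AddCommGroup M] [Module ℂ M]

theorem lift_compl₂_eq_tensorMul {ρ T : W →ₗ[ℂ] Module.End ℂ M} {h : W →ₗ[ℂ] M} {m : M}
    (hT : ∀ x, h x = T x m) (z : W ⊗[ℂ] W) :
    TensorProduct.lift (LinearMap.compl₂ ρ h) z = tensorMul ρ T z m := by
  induction z with
  | zero => simp
  | add a b ha hb => simp [ha, hb]
  | tmul x y => simp [hT]

end Generation

/-! ### The kernel of the antisymmetrizer -/

section Antisymmetrizer

variable {W : Type u} [AddCommGroup W] [Module ℂ W] {ψ : W ⊗[ℂ] W →ₗ[ℂ] W ⊗[ℂ] W}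

local notation "ι" => (TensorAlgebra.ι ℂ : W →ₗ[ℂ] TensorAlgebra ℂ W)

/-- The first twist acts on the first two factors of a product. -/
theorem twist_zero_mul (z : W ⊗[ℂ] W) (t : TensorAlgebra ℂ W) :
    twist ψ 0 (tensorMul ι ι z * t) = tensorMul ι ι (ψ z) * t := by
  have h : ∀ u : W ⊗[ℂ] W, cons W ((cons W).lTensor W
      (TensorProduct.assoc ℂ W W (TensorAlgebra ℂ W) (u ⊗ₜ t))) = tensorMul ι ι u * t := by
    intro u
    induction u with
    | zero => simp
    | tmul x y => simp [mul_assoc]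
    | add a b ha hb => simp only [TensorProduct.add_tmul, map_add, add_mul, ha, hb]
  induction z with
  | zero => simp
  | tmul x y =>
    rw [tensorMul_tmul, mul_assoc, ← h]
    simp [twist]
  | add a b ha hb => simp only [map_add, add_mul, ha, hb]

theorem twist_succ_cons (i : ℕ) (x : W) (t : TensorAlgebra ℂ W) :
    twist ψ (i + 1) (ι x * t) = ι x * twist ψ i t := by
  simp [twist]

theorem tensorMul_ι_mem (z : W ⊗[ℂ] W) : tensorMul ι ι z ∈ LinearMap.range ι ^ 2 := by
  induction z with
  | zero => simp
  | tmul x y =>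
    rw [tensorMul_tmul, pow_two]
    exact Submodule.mul_mem_mul ⟨x, rfl⟩ ⟨y, rfl⟩
  | add a b ha hb => rw [map_add]; exact add_mem ha hb

variable {B : Type*} [Ring B] [Algebra ℂ B] {Θ : TensorAlgebra ℂ W →ₐ[ℂ] B}

/-- An algebra map that satisfies the homogeneous relations turns every twist into the sign `-1`. -/
theorem twist_mem_and_apply (hΘ : IsClifford ψ 0 (Θ.toLinearMap ∘ₗ ι)) (i : ℕ) :
    ∀ n, i + 2 ≤ n → ∀ t ∈ LinearMap.range ι ^ n,
      twist ψ i t ∈ LinearMap.range ι ^ n ∧ Θ (twist ψ i t) = -Θ t := by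
  induction i with
  | zero =>
    intro n hn t ht
    obtain ⟨n, rfl⟩ := Nat.exists_eq_add_of_le hn
    rw [zero_add, pow_add] at ht
    induction ht using Submodule.mul_induction_on' with
    | add a _ b _ ha hb =>
      simp only [map_add, ha.2, hb.2, neg_add]
      exact ⟨add_mem ha.1 hb.1, trivial⟩
    | mem_mul_mem s hs t ht =>
      rw [pow_two] at hs
      induction hs using Submodule.mul_induction_on' with
      | add a _ b _ ha hb =>
        simp only [map_add, add_mul, ha.2, hb.2, neg_add]
        exact ⟨add_mem ha.1 hb.1, trivial⟩
      | mem_mul_mem a ha b hb =>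
        obtain ⟨x, rfl⟩ := ha
        obtain ⟨y, rfl⟩ := hb
        have h2 := hΘ (x ⊗ₜ y)
        rw [← tensorMul_tmul, twist_zero_mul]
        refine ⟨?_, ?_⟩
        · rw [zero_add, pow_add]
          exact Submodule.mul_mem_mul (tensorMul_ι_mem _) ht
        · rw [← algHom_tensorMul, ← algHom_tensorMul] at h2
          simp only [LinearMap.zero_apply, mul_zero, zero_smul] at h2
          rw [map_mul, map_mul, eq_neg_of_add_eq_zero_right h2, neg_mul]
  | succ i ih =>
    intro n hn t ht
    obtain ⟨n, rfl⟩ : ∃ k, n = k + 1 := ⟨n - 1, by omega⟩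
    rw [pow_succ'] at ht
    induction ht using Submodule.mul_induction_on' with
    | add a _ b _ ha hb =>
      simp only [map_add, ha.2, hb.2, neg_add]
      exact ⟨add_mem ha.1 hb.1, trivial⟩
    | mem_mul_mem s hs t ht =>
      obtain ⟨x, rfl⟩ := hs
      have := ih n (by omega) t ht
      rw [twist_succ_cons, pow_succ', map_mul, map_mul, this.2, mul_neg]
      exact ⟨Submodule.mul_mem_mul ⟨x, rfl⟩ this.1, rfl⟩

theorem wordOp_mem_and_apply (hΘ : IsClifford ψ 0 (Θ.toLinearMap ∘ₗ ι)) {n : ℕ}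
    (l : List (Fin n)) {t : TensorAlgebra ℂ W} (ht : t ∈ LinearMap.range ι ^ (n + 1)) :
    wordOp ψ l t ∈ LinearMap.range ι ^ (n + 1) ∧ Θ (wordOp ψ l t) = (-1 : ℂ) ^ l.length • Θ t := by
  induction l with
  | nil => simpa [wordOp] using ht
  | cons i l ih =>
    simp only [wordOp, List.map_cons, List.prod_cons, Module.End.mul_apply] at ih ⊢
    have := twist_mem_and_apply hΘ i (n + 1) (by omega) _ ih.1
    refine ⟨this.1, ?_⟩
    rw [this.2, ih.2, List.length_cons, pow_succ]
    simp

theorem sign_wordPerm {n : ℕ} (l : List (Fin n)) :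
    Equiv.Perm.sign (wordPerm l) = (-1) ^ l.length := by
  induction l with
  | nil => simp [wordPerm]
  | cons i l ih =>
    simp only [wordPerm, List.map_cons, List.prod_cons] at ih ⊢
    rw [map_mul, ih, List.length_cons, pow_succ', Equiv.Perm.sign_swap (Fin.castSucc_lt_succ).ne]

theorem antisymDeg_mem_and_apply (hΘ : IsClifford ψ 0 (Θ.toLinearMap ∘ₗ ι)) (n : ℕ)
    {t : TensorAlgebra ℂ W} (ht : t ∈ LinearMap.range ι ^ n) :
    antisymDeg ψ n t ∈ LinearMap.range ι ^ n ∧ Θ (antisymDeg ψ n t) = (n.factorial : ℂ) • Θ t := by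
  cases n with
  | zero => simpa [antisymDeg] using ht
  | succ n =>
    simp only [antisymDeg, LinearMap.sum_apply, LinearMap.smul_apply, map_sum, map_smul]
    refine ⟨sum_mem fun π _ => Submodule.smul_mem _ _ (wordOp_mem_and_apply hΘ _ ht).1, ?_⟩
    have : ∀ π : Equiv.Perm (Fin (n + 1)),
        ((Equiv.Perm.sign π : ℤ) : ℂ) • Θ (wordOp ψ (minWord π) t) = Θ t := by
      intro π
      have hs := sign_wordPerm (minWord π)
      rw [show wordPerm (minWord π) = π from (exists_minWord π).choose_spec.1] at hs
      rw [(wordOp_mem_and_apply hΘ _ ht).2, hs, smul_smul]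
      push_cast
      rw [← mul_pow]
      simp
    simp [this, Fintype.card_perm, Nat.cast_smul_eq_nsmul]

/-- The kernel of the antisymmetrizer consists of consequences of the quadratic relations
`x y + ∑ y_k x_k = 0`: modulo these, `A_n` is the multiplication by `n!`. -/
theorem map_eq_zero_of_antisym (hΘ : IsClifford ψ 0 (Θ.toLinearMap ∘ₗ ι))
    {t : TensorAlgebra ℂ W} (ht : antisym ψ t = 0) : Θ t = 0 := by
  -- `Θ'` is `Θ / n!` on tensors of degree `n`, so that `Θ' ∘ A = Θ`.
  let Θ' : TensorAlgebra ℂ W →ₗ[ℂ] B := DirectSum.toModule ℂ ℕ B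
      (fun n => ((n.factorial : ℂ)⁻¹ • Θ.toLinearMap) ∘ₗ (LinearMap.range ι ^ n).subtype) ∘ₗ
    (DirectSum.decomposeLinearEquiv (fun n : ℕ => LinearMap.range ι ^ n)).toLinearMap
  have hΘ' : ∀ n, ∀ s ∈ LinearMap.range ι ^ n, Θ' s = (n.factorial : ℂ)⁻¹ • Θ s := by
    intro n s hs
    lift s to ↥(LinearMap.range ι ^ n) using hs
    simp only [Θ', LinearMap.comp_apply, LinearEquiv.coe_coe,
      DirectSum.decomposeLinearEquiv_apply, DirectSum.decompose_coe]
    rw [← DirectSum.lof_eq_of ℂ, DirectSum.toModule_lof]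
    simp
  have key : ∀ s, Θ' (antisym ψ s) = Θ s := by
    intro s
    induction s using DirectSum.Decomposition.inductionOn
      (fun n : ℕ => LinearMap.range ι ^ n) with
    | zero => simp
    | add a b ha hb => simp [ha, hb]
    | homogeneous s =>
      rename_i n
      have h := antisymDeg_mem_and_apply hΘ n s.2
      rw [antisym_of_mem ψ s.2, hΘ' n _ h.1, h.2, smul_smul,
        inv_mul_cancel₀ (by exact_mod_cast n.factorial_ne_zero), one_smul]
  rw [← key, ht, map_zero]

end Antisymmetrizer

/-! ### Presentation of the braided Clifford algebra -/

section Universal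

variable {W : Type u} [AddCommGroup W] [Module ℂ W] {ψ : W ⊗[ℂ] W →ₗ[ℂ] W ⊗[ℂ] W}
  {F : W ⊗[ℂ] W →ₗ[ℂ] ℂ} {A : Type u} [Ring A] [Algebra ℂ A]

/-- `π : T(W) → A` presents `A` as the algebra generated by `W` with the Clifford relations. -/
structure IsPresentation (ψ : W ⊗[ℂ] W →ₗ[ℂ] W ⊗[ℂ] W) (F : W ⊗[ℂ] W →ₗ[ℂ] ℂ)
    (π : TensorAlgebra ℂ W →ₐ[ℂ] A) : Prop where
  surjective : Function.Surjective π
  isClifford : IsClifford ψ F (π.toLinearMap ∘ₗ TensorAlgebra.ι ℂ)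
  exists_lift : ∀ {B : Type u} [Ring B] [Algebra ℂ B] {f : W →ₗ[ℂ] B}, IsClifford ψ F f →
    ∃ φ : A →ₐ[ℂ] B, φ.comp π = TensorAlgebra.lift ℂ f

/-- The Clifford relations `x y + ∑ y_k x_k = 2 F(x, y)` in the tensor algebra. -/
inductive QuadRel (ψ : W ⊗[ℂ] W →ₗ[ℂ] W ⊗[ℂ] W) (F : W ⊗[ℂ] W →ₗ[ℂ] ℂ) :
    TensorAlgebra ℂ W → TensorAlgebra ℂ W → Prop
  | of (z : W ⊗[ℂ] W) : QuadRel ψ F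
      (tensorMul (TensorAlgebra.ι ℂ) (TensorAlgebra.ι ℂ) z +
        tensorMul (TensorAlgebra.ι ℂ) (TensorAlgebra.ι ℂ) (ψ z)) ((2 * F z) • 1)

/-- Dividing by the Clifford relations gives an algebra that they present. -/
theorem isPresentation_ringQuot :
    IsPresentation ψ F (RingQuot.mkAlgHom ℂ (QuadRel ψ F)) where
  surjective := RingQuot.mkAlgHom_surjective ℂ (QuadRel ψ F)
  isClifford := by
    intro z
    rw [← algHom_tensorMul, ← algHom_tensorMul, ← map_add,
      RingQuot.mkAlgHom_rel ℂ (QuadRel.of z)]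
    simp
  exists_lift := by
    intro B _ _ f hf
    refine ⟨RingQuot.liftAlgHom ℂ ⟨TensorAlgebra.lift ℂ f, ?_⟩, ?_⟩
    · rintro _ _ ⟨z⟩
      have h : (TensorAlgebra.lift ℂ f).toLinearMap ∘ₗ TensorAlgebra.ι ℂ = f := by ext; simp
      rw [map_add, algHom_tensorMul, algHom_tensorMul, h, hf z]
      simp
    · ext; simp

namespace IsPresentation

variable {π : TensorAlgebra ℂ W →ₐ[ℂ] A} (hπ : IsPresentation ψ F π)
include hπ

/-- Recursion in the algebra `A` of the Clifford relations: an element `x ∈ W` is moved past the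
factors of `a ∈ A` by the rule `x y = c F(x, y) - ∑ y_k x_k`, and it acts by `h₀` once it has
passed them all. The action of `A` on `M` and the vector `m₀` say what remains of `a` after the
contraction of a factor. -/
theorem exists_cross {M : Type u} [AddCommGroup M] [Module ℂ M] (hψ : BraidData ψ F) (c : ℂ)
    (ρ : A →ₐ[ℂ] Module.End ℂ M) (m₀ : M) (h₀ : W →ₗ[ℂ] M) :
    ∃ h : A →ₗ[ℂ] W →ₗ[ℂ] M, h 1 = h₀ ∧ ∀ x y a, h (π (TensorAlgebra.ι ℂ y) * a) x =
      (c * F (x ⊗ₜ y)) • ρ a m₀ - TensorProduct.lift (LinearMap.compl₂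
        (ρ.toLinearMap ∘ₗ π.toLinearMap ∘ₗ TensorAlgebra.ι ℂ) (h a)) (ψ (x ⊗ₜ y)) := by
  obtain ⟨Φ, hΦ⟩ := hπ.exists_lift ((hπ.isClifford.map ρ).crossStep hψ c)
  have hΦ' : ∀ y, Φ (π (TensorAlgebra.ι ℂ y)) =
      crossStep ψ (c • F) (ρ.toLinearMap ∘ₗ π.toLinearMap ∘ₗ TensorAlgebra.ι ℂ) y := by
    intro y
    simpa using AlgHom.congr_fun hΦ (TensorAlgebra.ι ℂ y)
  have hfst : ∀ a, (Φ a (m₀, h₀)).1 = ρ a m₀ := by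
    intro a
    induction a using left_induction_of_surjective hπ.surjective with
    | one => simp
    | mul x a ih => simp [hΦ', ih]
    | smul c a ih => simp [ih]
    | add a b ha hb => simp [ha, hb]
  refine ⟨LinearMap.snd ℂ _ _ ∘ₗ LinearMap.applyₗ (m₀, h₀) ∘ₗ Φ.toLinearMap, by simp, ?_⟩
  intro x y a
  change (Φ (π (TensorAlgebra.ι ℂ y) * a) (m₀, h₀)).2 x = _
  rw [map_mul, Module.End.mul_apply, hΦ', crossStep_snd, hfst]
  rfl

/-- The contraction descends to the algebra of the Clifford relations. -/
theorem exists_contract (hψ : BraidData ψ F) :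
    ∃ T : W →ₗ[ℂ] Module.End ℂ A, (∀ x, T x 1 = 0) ∧
      ∀ x y, T x * LinearMap.mulLeft ℂ (π (TensorAlgebra.ι ℂ y)) = F (x ⊗ₜ y) • 1 -
        tensorMul (LinearMap.mul ℂ A ∘ₗ π.toLinearMap ∘ₗ TensorAlgebra.ι ℂ) T (ψ (x ⊗ₜ y)) := by
  obtain ⟨h, h1, h2⟩ := hπ.exists_cross hψ 1 (Algebra.lmul ℂ A) 1 0
  refine ⟨h.flip, fun x => by simp [h1], fun x y => LinearMap.ext fun a => ?_⟩
  rw [Module.End.mul_apply, LinearMap.mulLeft_apply, LinearMap.flip_apply, h2,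
    lift_compl₂_eq_tensorMul (T := h.flip) (m := a) (fun x => rfl)]
  simp
  rfl

/-- The elements of `λ_F⁻¹(ker A)` are consequences of the Clifford relations. On the algebra `A` of
these relations the operators `x - ι_x` satisfy the homogeneous relations, so they define
a map `θ : T(W) → A` that vanishes on the kernel of the antisymmetrizer, and `θ ∘ λ_F` is the
projection `T(W) → A`. -/
theorem map_eq_zero (hψ : BraidData ψ F) {t : TensorAlgebra ℂ W}
    (ht : antisym ψ (chevalley ψ F t) = 0) : π t = 0 := by
  obtain ⟨T, hT1, hT⟩ := hπ.exists_contract hψ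
  set ρ : W →ₗ[ℂ] Module.End ℂ A :=
    LinearMap.mul ℂ A ∘ₗ π.toLinearMap ∘ₗ TensorAlgebra.ι ℂ with hρ
  replace hT : ∀ x y, T x * ρ y = F (x ⊗ₜ y) • 1 - tensorMul ρ T (ψ (x ⊗ₜ y)) := hT
  have hρC : IsClifford ψ F ρ := hπ.isClifford.map (Algebra.lmul ℂ A)
  -- The contractions satisfy the homogeneous relations, since they do so on `1`.
  have hTT : ∀ z, tensorMul T T z + tensorMul T T (ψ z) = 0 := by
    intro z
    refine LinearMap.ext fun a => ?_
    induction a using left_induction_of_surjective hπ.surjective generalizing z with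
    | one =>
      have h0 : ∀ z, tensorMul T T z 1 = 0 := by
        intro z
        induction z with
        | zero => simp
        | tmul x y => simp [hT1]
        | add a b ha hb => simp [ha, hb]
      simp [h0]
    | smul c a ih => rw [map_smul, ih]; simp
    | add a b ha hb => rw [map_add, ha, hb]; simp
    | mul y a ih =>
      have := clifford_of_cross hψ (ρ := ρ) (T := T) 1 0 (by simpa using hT) a
        (by simpa using ih) y z
      simpa [hρ] using this
  have hTρ : ∀ z, tensorMul T ρ z = F z • 1 - tensorMul ρ T (ψ z) := by
    intro z
    induction z with
    | zero => simp
    | tmul x y => simp [hT]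
    | add a b ha hb => simp only [map_add, ha, hb, add_smul]; abel
  have hsub : ∀ z, tensorMul (ρ - T) (ρ - T) z =
      tensorMul ρ ρ z - tensorMul ρ T z - tensorMul T ρ z + tensorMul T T z := by
    intro z
    induction z with
    | zero => simp
    | tmul x y => simp [sub_mul, mul_sub]; abel
    | add a b ha hb => simp only [map_add, ha, hb]; abel
  have hC : IsClifford ψ 0 (ρ - T) := by
    intro z
    have h1 := hρC z
    have h2 := hTT z
    rw [hsub, hsub, hTρ, hTρ, hψ.inv_apply, hψ.symm_apply, eq_sub_of_add_eq h1,
      eq_neg_of_add_eq_zero_left h2]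
    simp only [two_mul, add_smul, LinearMap.zero_apply, add_zero, zero_smul]
    abel
  let Θ := TensorAlgebra.lift ℂ (ρ - T)
  have hΘ : IsClifford ψ 0 (Θ.toLinearMap ∘ₗ TensorAlgebra.ι ℂ) := by
    have : Θ.toLinearMap ∘ₗ TensorAlgebra.ι ℂ = ρ - T := by ext; simp [Θ]
    rwa [this]
  have hΘcons : ∀ x t, Θ (TensorAlgebra.ι ℂ x * t) 1 = ρ x (Θ t 1) - T x (Θ t 1) := by
    intro x t
    simp [Θ]
  have hcontract : ∀ t x, Θ (contract ψ F t x) 1 = T x (Θ t 1) := by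
    intro t
    induction t using left_induction with
    | h1 => simp [hT1]
    | hs c t h => simp [h]
    | ha s t hs ht => simp [hs, ht]
    | hc y t ih =>
      intro x
      have h1 : ∀ z, Θ (LinearMap.mul' ℂ (TensorAlgebra ℂ W)
          (TensorProduct.map (TensorAlgebra.ι ℂ) (contract ψ F t) z)) 1 =
          tensorMul ρ T z (Θ t 1) - tensorMul T T z (Θ t 1) := by
        intro z
        induction z with
        | zero => simp
        | tmul a b => simp [← ih, Θ]
        | add a b ha hb =>
          simp only [map_add, LinearMap.add_apply, ha, hb]; abel
      have h2 := LinearMap.congr_fun (hTT (x ⊗ₜ y)) (Θ t 1)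
      have h3 := LinearMap.congr_fun (hT x y) (Θ t 1)
      simp only [LinearMap.add_apply, tensorMul_tmul, Module.End.mul_apply,
        LinearMap.zero_apply, LinearMap.sub_apply, LinearMap.smul_apply,
        Module.End.one_apply] at h2 h3
      rw [contract_cons, map_sub, LinearMap.sub_apply, h1, hΘcons, map_sub, h3,
        eq_neg_of_add_eq_zero_left h2]
      simp only [map_smul, LinearMap.smul_apply]
      abel
  -- The contractions in `x + ι_x` and `x - ι_x` cancel.
  have hinv : ∀ t, Θ (chevalley ψ F t) 1 = π t := by
    intro t
    induction t using left_induction with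
    | h1 => simp
    | hs c t h => simp [h]
    | ha s t hs ht => simp [hs, ht]
    | hc x t ih =>
      rw [chevalley_cons, map_add, LinearMap.add_apply, hΘcons, hcontract, ih]
      simp [hρ]
  rw [← hinv, map_eq_zero_of_antisym hΘ ht, LinearMap.zero_apply]

end IsPresentation

theorem chevalley_tensorMul (z : W ⊗[ℂ] W) :
    chevalley ψ F (tensorMul (TensorAlgebra.ι ℂ) (TensorAlgebra.ι ℂ) z) =
      tensorMul (TensorAlgebra.ι ℂ) (TensorAlgebra.ι ℂ) z + F z • 1 := by
  induction z with
  | zero => simp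
  | add a b ha hb => simp only [map_add, ha, hb, add_smul]; abel
  | tmul x y =>
    have h1 : ∀ x y, contract ψ F (TensorAlgebra.ι ℂ y) x = F (x ⊗ₜ y) • 1 := by
      intro x y
      have := contract_cons ψ F x y 1
      simpa using this
    have h2 : chevalley ψ F (TensorAlgebra.ι ℂ y) = TensorAlgebra.ι ℂ y := by
      have := chevalley_cons ψ F y 1
      simpa using this
    rw [tensorMul_tmul, chevalley_cons, h2, h1]

/-- The homogeneous quadratic relations lie in the kernel of the antisymmetrizer. -/
theorem antisym_tensorMul (hψ : BraidData ψ F) (z : W ⊗[ℂ] W) :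
    antisym ψ (tensorMul (TensorAlgebra.ι ℂ) (TensorAlgebra.ι ℂ) (z + ψ z)) = 0 := by
  rw [antisym_of_mem ψ (tensorMul_ι_mem _)]
  -- Every word operator in degree `2` fixes `z + ψ z`, and the signs of the two permutations
  -- cancel.
  have h0 : twist ψ 0 (tensorMul (TensorAlgebra.ι ℂ) (TensorAlgebra.ι ℂ) (z + ψ z)) =
      tensorMul (TensorAlgebra.ι ℂ) (TensorAlgebra.ι ℂ) (z + ψ z) := by
    have := twist_zero_mul (ψ := ψ) (z + ψ z) 1
    rwa [mul_one, mul_one, map_add ψ, hψ.inv_apply, add_comm (ψ z)] at this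
  have h1 : ∀ l : List (Fin 1),
      wordOp ψ l (tensorMul (TensorAlgebra.ι ℂ) (TensorAlgebra.ι ℂ) (z + ψ z)) =
        tensorMul (TensorAlgebra.ι ℂ) (TensorAlgebra.ι ℂ) (z + ψ z) := by
    intro l
    induction l with
    | nil => simp [wordOp]
    | cons i l ih =>
      simp only [wordOp, List.map_cons, List.prod_cons, Module.End.mul_apply] at ih ⊢
      rw [ih, Subsingleton.elim i 0]
      exact h0
  have h2 : ∑ π : Equiv.Perm (Fin 2), (Equiv.Perm.sign π : ℤ) = 0 := by decide
  simp only [antisymDeg, LinearMap.sum_apply, LinearMap.smul_apply, h1, ← Finset.sum_smul]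
  rw [← Int.cast_sum, h2]
  simp

/-- The braided Clifford algebra is presented by the Clifford relations. -/
theorem isPresentation_cl (hψ : BraidData ψ F) :
    IsPresentation ψ F (RingQuot.mkAlgHom ℂ (Rel ψ F)) where
  surjective := RingQuot.mkAlgHom_surjective ℂ (Rel ψ F)
  isClifford := by
    intro z
    have h : Rel ψ F (tensorMul (TensorAlgebra.ι ℂ) (TensorAlgebra.ι ℂ) (z + ψ z) -
        (2 * F z) • 1) 0 := by
      refine Rel.of _ ?_
      rw [map_sub, chevalley_tensorMul, map_smul, chevalley_one, map_add F, hψ.symm_apply,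
        ← two_mul, add_sub_cancel_right, antisym_tensorMul hψ]
    have h' := RingQuot.mkAlgHom_rel ℂ h
    rw [map_sub, map_zero, sub_eq_zero, map_add (tensorMul _ _), map_add] at h'
    rw [← algHom_tensorMul, ← algHom_tensorMul, h']
    simp
  exists_lift := by
    intro B _ _ f hf
    have hQ : IsPresentation ψ F (RingQuot.mkAlgHom ℂ (QuadRel ψ F)) := isPresentation_ringQuot
    obtain ⟨φ, hφ⟩ := hQ.exists_lift hf
    refine ⟨RingQuot.liftAlgHom ℂ ⟨TensorAlgebra.lift ℂ f, ?_⟩, ?_⟩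
    · intro a b hab
      obtain ⟨ht, rfl⟩ : antisym ψ (chevalley ψ F a) = 0 ∧ b = 0 := by
        induction hab with
        | of h => exact ⟨h, rfl⟩
      rw [← hφ, AlgHom.comp_apply, hQ.map_eq_zero hψ ht, map_zero, map_zero]
    · ext; simp

end Universal

/-! ### The braid and the form on the doubled space -/

section DoubleData

variable {W : Type u} [AddCommGroup W] [Module ℂ W]

/-- The two inclusions `W → W ⊕ W`: the first one for `false`, the second one for `true`. -/
noncomputable def inc (W : Type u) [AddCommGroup W] [Module ℂ W] (i : Bool) : W →ₗ[ℂ] W × W :=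
  bif i then LinearMap.inr ℂ W W else LinearMap.inl ℂ W W

/-- The coefficient of `F` on the `(i, j)` summand of the form `E`. -/
noncomputable def formCoeff (i j : Bool) : ℂ := if i = j then 1 else -(1 / 2)

theorem prod_eq_inc (v : W × W) : v = inc W false v.1 + inc W true v.2 := by
  ext <;> simp [inc]

theorem doubleBraid_map_inc (ψ : W ⊗[ℂ] W →ₗ[ℂ] W ⊗[ℂ] W) (i j : Bool) (z : W ⊗[ℂ] W) :
    doubleBraid ψ (TensorProduct.map (inc W i) (inc W j) z) =
      TensorProduct.map (inc W j) (inc W i) (ψ z) := by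
  induction z with
  | zero => simp
  | add a b ha hb => simp only [map_add, ha, hb]
  | tmul x y => cases i <;> cases j <;> simp [doubleBraid, inc]

theorem doubleForm_map_inc (F : W ⊗[ℂ] W →ₗ[ℂ] ℂ) (i j : Bool) (z : W ⊗[ℂ] W) :
    doubleForm F (TensorProduct.map (inc W i) (inc W j) z) = formCoeff i j * F z := by
  induction z with
  | zero => simp
  | add a b ha hb => simp only [map_add, ha, hb, mul_add]
  | tmul x y => cases i <;> cases j <;> simp [doubleForm, inc, formCoeff]

theorem formCoeff_comm (i j : Bool) : formCoeff i j = formCoeff j i := by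
  simp [formCoeff, eq_comm]

/-- Linear maps on the doubled tensor square agree if they agree on the four summands. -/
theorem double_ext {X : Type*} [AddCommMonoid X] [Module ℂ X]
    {f g : (W × W) ⊗[ℂ] (W × W) →ₗ[ℂ] X}
    (h : ∀ i j z, f (TensorProduct.map (inc W i) (inc W j) z) =
      g (TensorProduct.map (inc W i) (inc W j) z)) : f = g := by
  refine TensorProduct.ext' fun v w => ?_
  have h' : ∀ i j x y, f (inc W i x ⊗ₜ inc W j y) = g (inc W i x ⊗ₜ inc W j y) :=
    fun i j x y => by simpa using h i j (x ⊗ₜ y)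
  rw [prod_eq_inc v, prod_eq_inc w]
  simp only [TensorProduct.add_tmul, TensorProduct.tmul_add, map_add, h']

theorem triple_ext {X : Type*} [AddCommMonoid X] [Module ℂ X]
    {f g : ((W × W) ⊗[ℂ] (W × W)) ⊗[ℂ] (W × W) →ₗ[ℂ] X}
    (h : ∀ i j k w,
      f (TensorProduct.map (TensorProduct.map (inc W i) (inc W j)) (inc W k) w) =
      g (TensorProduct.map (TensorProduct.map (inc W i) (inc W j)) (inc W k) w)) : f = g := by
  refine TensorProduct.ext_threefold fun u v w => ?_
  have h' : ∀ i j k x y z, f ((inc W i x ⊗ₜ inc W j y) ⊗ₜ inc W k z) =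
      g ((inc W i x ⊗ₜ inc W j y) ⊗ₜ inc W k z) :=
    fun i j k x y z => by simpa using h i j k ((x ⊗ₜ y) ⊗ₜ z)
  rw [prod_eq_inc u, prod_eq_inc v, prod_eq_inc w]
  simp only [TensorProduct.add_tmul, TensorProduct.tmul_add, map_add, h']

theorem onLeft_map_inc (ψ : W ⊗[ℂ] W →ₗ[ℂ] W ⊗[ℂ] W) (i j k : Bool) (w : (W ⊗[ℂ] W) ⊗[ℂ] W) :
    onLeft (doubleBraid ψ)
        (TensorProduct.map (TensorProduct.map (inc W i) (inc W j)) (inc W k) w) =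
      TensorProduct.map (TensorProduct.map (inc W j) (inc W i)) (inc W k) (onLeft ψ w) := by
  induction w with
  | zero => simp
  | add a b ha hb => simp only [map_add, ha, hb]
  | tmul u x => simp [doubleBraid_map_inc]

theorem onRight_map_inc (ψ : W ⊗[ℂ] W →ₗ[ℂ] W ⊗[ℂ] W) (i j k : Bool)
    (w : (W ⊗[ℂ] W) ⊗[ℂ] W) :
    onRight (doubleBraid ψ)
        (TensorProduct.map (TensorProduct.map (inc W i) (inc W j)) (inc W k) w) =
      TensorProduct.map (TensorProduct.map (inc W i) (inc W k)) (inc W j) (onRight ψ w) := by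
  obtain ⟨w, rfl⟩ := (TensorProduct.assoc ℂ W W W).symm.surjective w
  induction w with
  | zero => simp
  | add a b ha hb => simp only [map_add, ha, hb]
  | tmul x u =>
    rw [TensorProduct.map_map_assoc_symm, onRight_assoc_symm, TensorProduct.map_map_assoc_symm,
      TensorProduct.map_tmul, TensorProduct.map_tmul, onRight_assoc_symm, doubleBraid_map_inc]

theorem formLeft_map_inc (F : W ⊗[ℂ] W →ₗ[ℂ] ℂ) (i j k : Bool) (w : (W ⊗[ℂ] W) ⊗[ℂ] W) :
    formLeft (doubleForm F)
        (TensorProduct.map (TensorProduct.map (inc W i) (inc W j)) (inc W k) w) =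
      formCoeff i j • inc W k (formLeft F w) := by
  induction w with
  | zero => simp
  | add a b ha hb => simp only [map_add, ha, hb, smul_add]
  | tmul u x => simp [doubleForm_map_inc, mul_smul]

theorem formRight_map_inc (F : W ⊗[ℂ] W →ₗ[ℂ] ℂ) (i j k : Bool) (w : (W ⊗[ℂ] W) ⊗[ℂ] W) :
    formRight (doubleForm F)
        (TensorProduct.map (TensorProduct.map (inc W i) (inc W j)) (inc W k) w) =
      formCoeff j k • inc W i (formRight F w) := by
  obtain ⟨w, rfl⟩ := (TensorProduct.assoc ℂ W W W).symm.surjective w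
  induction w with
  | zero => simp
  | add a b ha hb => simp only [map_add, ha, hb, smul_add]
  | tmul x u =>
    rw [TensorProduct.map_map_assoc_symm, TensorProduct.map_tmul, formRight_assoc_symm,
      formRight_assoc_symm, doubleForm_map_inc, map_smul, smul_smul]

/-- The hypotheses on `(ψ, F)` pass to `(Ψ, E)`: `Ψ` permutes the labels of the summands together
with the factors, so the coefficient of `F` is the same on both sides of each identity. -/
theorem BraidData.double {ψ : W ⊗[ℂ] W →ₗ[ℂ] W ⊗[ℂ] W} {F : W ⊗[ℂ] W →ₗ[ℂ] ℂ}
    (h : BraidData ψ F) : BraidData (doubleBraid ψ) (doubleForm F) where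
  braid := by
    unfold BraidEquation
    apply triple_ext
    intro i j k w
    simp only [LinearMap.comp_apply, onLeft_map_inc, onRight_map_inc, h.braid_apply]
  inv := double_ext fun i j z => by
    simp only [LinearMap.comp_apply, doubleBraid_map_inc, h.inv_apply, LinearMap.id_apply]
  cov := triple_ext fun i j k w => by
    change formLeft (doubleForm F) (onRight (doubleBraid ψ) _) =
      formRight (doubleForm F) (onLeft (doubleBraid ψ) _)
    rw [onLeft_map_inc, onRight_map_inc, formLeft_map_inc, formRight_map_inc, h.cov_apply]
  symm := double_ext fun i j z => by
    simp only [LinearMap.comp_apply, doubleBraid_map_inc, doubleForm_map_inc, h.symm_apply,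
      formCoeff_comm]

/-- The Clifford relations of `(Ψ, E)`, summand by summand. -/
theorem isClifford_double_iff {B : Type*} [Ring B] [Algebra ℂ B]
    {ψ : W ⊗[ℂ] W →ₗ[ℂ] W ⊗[ℂ] W} {F : W ⊗[ℂ] W →ₗ[ℂ] ℂ} (f : W × W →ₗ[ℂ] B) :
    IsClifford (doubleBraid ψ) (doubleForm F) f ↔
      ∀ i j z, tensorMul (f ∘ₗ inc W i) (f ∘ₗ inc W j) z +
        tensorMul (f ∘ₗ inc W j) (f ∘ₗ inc W i) (ψ z) = (2 * formCoeff i j * F z) • (1 : B) := by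
  have h1 : ∀ i j z, tensorMul f f (TensorProduct.map (inc W i) (inc W j) z) =
      tensorMul (f ∘ₗ inc W i) (f ∘ₗ inc W j) z := by
    intro i j z
    induction z with
    | zero => simp
    | tmul x y => simp
    | add a b ha hb => simp only [map_add, ha, hb]
  constructor
  · intro h i j z
    have := h (TensorProduct.map (inc W i) (inc W j) z)
    rwa [doubleBraid_map_inc, doubleForm_map_inc, h1, h1, ← mul_assoc] at this
  · intro h z
    have : tensorMul f f + tensorMul f f ∘ₗ doubleBraid ψ =
        LinearMap.toSpanSingleton ℂ B 1 ∘ₗ ((2 : ℂ) • doubleForm F) :=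
      double_ext fun i j z => by
        simpa [doubleBraid_map_inc, doubleForm_map_inc, h1, mul_assoc] using h i j z
    simpa using LinearMap.congr_fun this z

end DoubleData

/-! ### The factorization of the doubled algebra -/

section Factorization

variable {W : Type u} [AddCommGroup W] [Module ℂ W] {ψ : W ⊗[ℂ] W →ₗ[ℂ] W ⊗[ℂ] W}
  {F : W ⊗[ℂ] W →ₗ[ℂ] ℂ} {A D : Type u} [Ring A] [Algebra ℂ A] [Ring D] [Algebra ℂ D]
  {π : TensorAlgebra ℂ W →ₐ[ℂ] A} {πD : TensorAlgebra ℂ (W × W) →ₐ[ℂ] D}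

/-- The algebra of the doubled Clifford relations acts on `A ⊗ A`: the first copy of `W` by left
multiplication, the second one by being moved past the first tensor factor and multiplied to the
second one. -/
theorem exists_double_action (hψ : BraidData ψ F) (hπ : IsPresentation ψ F π)
    (hD : IsPresentation (doubleBraid ψ) (doubleForm F) πD) :
    ∃ K : D →ₐ[ℂ] Module.End ℂ (A ⊗[ℂ] A),
      (∀ x a b, K (πD (TensorAlgebra.ι ℂ (x, 0))) (a ⊗ₜ b) = (π (TensorAlgebra.ι ℂ x) * a) ⊗ₜ b) ∧
      ∀ x b, K (πD (TensorAlgebra.ι ℂ (0, x))) (1 ⊗ₜ b) = 1 ⊗ₜ (π (TensorAlgebra.ι ℂ x) * b) := by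
  set g : W →ₗ[ℂ] A := π.toLinearMap ∘ₗ TensorAlgebra.ι ℂ with hg
  let L : A →ₐ[ℂ] Module.End ℂ (A ⊗[ℂ] A) :=
    (Module.End.rTensorAlgHom ℂ A A).comp (Algebra.lmul ℂ A)
  have hL : ∀ a b c, L a (b ⊗ₜ c) = (a * b) ⊗ₜ c := fun a b c => rfl
  let ρM : A →ₐ[ℂ] Module.End ℂ (A →ₗ[ℂ] A ⊗[ℂ] A) := AlgHom.ofLinearMap
    (LinearMap.llcomp ℂ A (A ⊗[ℂ] A) (A ⊗[ℂ] A) ∘ₗ L.toLinearMap)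
    (by ext f a; simp) (fun a b => by ext f c; simp)
  have hρM : ∀ a f b, ρM a f b = L a (f b) := fun a f b => rfl
  -- The recursion takes values in maps `b ↦ h a x b`, so that the result is linear in `b`. The
  -- coefficient `-1` comes from `2 E = -F` on the mixed summands.
  obtain ⟨h, h1, h2⟩ := hπ.exists_cross hψ (-1) ρM (TensorProduct.mk ℂ A A 1)
    ((LinearMap.llcomp ℂ A A (A ⊗[ℂ] A) (TensorProduct.mk ℂ A A 1)) ∘ₗ LinearMap.mul ℂ A ∘ₗ g)
  let T : W →ₗ[ℂ] Module.End ℂ (A ⊗[ℂ] A) :=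
    TensorProduct.uncurry (RingHom.id ℂ) A A (A ⊗[ℂ] A) ∘ₗ h.flip
  have hTh : ∀ x a b, T x (a ⊗ₜ b) = h a x b := fun x a b => rfl
  set ρ : W →ₗ[ℂ] Module.End ℂ (A ⊗[ℂ] A) := L.toLinearMap ∘ₗ g with hρ
  have hT1 : ∀ x b, T x (1 ⊗ₜ b) = 1 ⊗ₜ (g x * b) := by
    intro x b
    rw [hTh, h1]; rfl
  have hT : ∀ x y, T x * ρ y = ((-1 : ℂ) * F (x ⊗ₜ y)) • 1 - tensorMul ρ T (ψ (x ⊗ₜ y)) := by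
    intro x y
    refine TensorProduct.ext' fun a b => ?_
    have h3 : ∀ z, TensorProduct.lift (LinearMap.compl₂
        (ρM.toLinearMap ∘ₗ π.toLinearMap ∘ₗ TensorAlgebra.ι ℂ) (h a)) z b =
        tensorMul ρ T z (a ⊗ₜ b) := by
      intro z
      induction z with
      | zero => simp
      | tmul p q => simp [hρM, hTh, hρ, hg]
      | add p q hp hq => simp only [map_add, LinearMap.add_apply, hp, hq]
    have h4 := LinearMap.congr_fun (h2 x y a) b
    rw [LinearMap.sub_apply, h3] at h4
    rw [Module.End.mul_apply, LinearMap.sub_apply]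
    have h5 : ρ y (a ⊗ₜ[ℂ] b) = (π (TensorAlgebra.ι ℂ y) * a) ⊗ₜ b := rfl
    rw [h5, hTh, h4]
    simp [hρM, hL]
  have hρC : IsClifford ψ F ρ := hπ.isClifford.map L
  have hTC : IsClifford ψ F T := by
    intro z
    refine TensorProduct.ext' fun a b => ?_
    induction a using left_induction_of_surjective hπ.surjective generalizing z with
    | smul c a ih => rw [← TensorProduct.smul_tmul', map_smul, map_smul, ih]
    | add a a' ha hb => rw [TensorProduct.add_tmul, map_add, map_add, ha, hb]
    | one =>
      have h3 : ∀ z, tensorMul T T z (1 ⊗ₜ b) = 1 ⊗ₜ (tensorMul g g z * b) := by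
        intro z
        induction z with
        | zero => simp
        | tmul p q => simp [hT1, mul_assoc]
        | add p q hp hq =>
          simp only [map_add, LinearMap.add_apply, hp, hq, add_mul, TensorProduct.tmul_add]
      rw [LinearMap.add_apply, h3, h3, ← TensorProduct.tmul_add, ← add_mul, hπ.isClifford z]
      simp
    | mul y a ih =>
      have h3 := clifford_of_cross hψ (-1) 1 hT (a ⊗ₜ b)
        (by intro z; simpa using ih z) y z
      have h5 : ρ y (a ⊗ₜ[ℂ] b) = (π (TensorAlgebra.ι ℂ y) * a) ⊗ₜ b := rfl
      rw [h5] at h3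
      simpa using h3
  have hTρ : ∀ z, tensorMul T ρ z + tensorMul ρ T (ψ z) = (-F z) • 1 := by
    intro z
    induction z with
    | zero => simp
    | tmul x y => rw [tensorMul_tmul, hT]; simp
    | add a b ha hb =>
      rw [map_add F, neg_add, add_smul, ← ha, ← hb]; simp only [map_add]; abel
  have hκ : IsClifford (doubleBraid ψ) (doubleForm F) (LinearMap.coprod ρ T) := by
    rw [isClifford_double_iff]
    have hf : LinearMap.coprod ρ T ∘ₗ inc W false = ρ := by simp [inc]
    have ht : LinearMap.coprod ρ T ∘ₗ inc W true = T := by simp [inc]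
    intro i j z
    cases i <;> cases j <;> simp only [hf, ht]
    · simpa [formCoeff] using hρC z
    · have := hTρ (ψ z)
      rw [hψ.inv_apply, hψ.symm_apply] at this
      rw [add_comm, this]
      congr 1
      simp [formCoeff]
    · rw [hTρ]
      congr 1
      simp [formCoeff]
    · simpa [formCoeff] using hTC z
  obtain ⟨K, hK⟩ := hD.exists_lift hκ
  have hK' : ∀ v, K (πD (TensorAlgebra.ι ℂ v)) = LinearMap.coprod ρ T v := by
    intro v
    simpa using AlgHom.congr_fun hK (TensorAlgebra.ι ℂ v)
  refine ⟨K, fun x a b => ?_, fun x b => ?_⟩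
  · rw [hK']
    simp [hρ, hL, hg]
  · rw [hK']
    simp [hT1, hg]

variable {ℓm ℓp : A →ₐ[ℂ] D}
  (hm : ∀ x, ℓm (π (TensorAlgebra.ι ℂ x)) = πD (TensorAlgebra.ι ℂ (x, 0)))
  (hp : ∀ x, ℓp (π (TensorAlgebra.ι ℂ x)) = πD (TensorAlgebra.ι ℂ (0, x)))
include hm hp

/-- The action of `ℓ₋(a) ℓ₊(b)` on `1 ⊗ 1` gives `a ⊗ b` back. -/
theorem factorization_injective (hψ : BraidData ψ F) (hπ : IsPresentation ψ F π)
    (hD : IsPresentation (doubleBraid ψ) (doubleForm F) πD) :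
    Function.Injective
      (LinearMap.mul' ℂ D ∘ₗ TensorProduct.map ℓm.toLinearMap ℓp.toLinearMap) := by
  obtain ⟨K, hK1, hK2⟩ := exists_double_action hψ hπ hD
  have h1 : ∀ a b c, K (ℓm a) (b ⊗ₜ c) = (a * b) ⊗ₜ c := by
    intro a
    induction a using left_induction_of_surjective hπ.surjective with
    | one => simp
    | mul x a ih => intro b c; simp [hm, ih, hK1, mul_assoc]
    | smul r a ih => intro b c; simp [ih, TensorProduct.smul_tmul']
    | add a a' h h' => intro b c; simp [h, h', add_mul, TensorProduct.add_tmul]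
  have h2 : ∀ a c, K (ℓp a) (1 ⊗ₜ c) = 1 ⊗ₜ (a * c) := by
    intro a
    induction a using left_induction_of_surjective hπ.surjective with
    | one => simp
    | mul x a ih => intro c; simp [hp, ih, hK2, mul_assoc]
    | smul r a ih => intro c; simp [ih]
    | add a a' h h' => intro c; simp [h, h', add_mul, TensorProduct.tmul_add]
  have h3 : ∀ t, K ((LinearMap.mul' ℂ D ∘ₗ
      TensorProduct.map ℓm.toLinearMap ℓp.toLinearMap) t) (1 ⊗ₜ 1) = t := by
    intro t
    induction t with
    | zero => simp
    | tmul a b => simp [h1, h2]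
    | add s t hs ht => rw [map_add, map_add, LinearMap.add_apply, hs, ht]
  exact fun s t hst => by rw [← h3 s, hst, h3]

/-- The relation `ℓ₊(x) ℓ₋(y) = -∑ ℓ₋(y_k) ℓ₊(x_k) - F(x, y)` between the two copies of `W`. -/
theorem mixed_relation
    (hD : IsPresentation (doubleBraid ψ) (doubleForm F) πD) (z : W ⊗[ℂ] W) :
    tensorMul (ℓp.toLinearMap ∘ₗ π.toLinearMap ∘ₗ TensorAlgebra.ι ℂ)
        (ℓm.toLinearMap ∘ₗ π.toLinearMap ∘ₗ TensorAlgebra.ι ℂ) z =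
      -tensorMul (ℓm.toLinearMap ∘ₗ π.toLinearMap ∘ₗ TensorAlgebra.ι ℂ)
        (ℓp.toLinearMap ∘ₗ π.toLinearMap ∘ₗ TensorAlgebra.ι ℂ) (ψ z) - F z • 1 := by
  have h := (isClifford_double_iff _).1 hD.isClifford true false z
  have h1 : (πD.toLinearMap ∘ₗ TensorAlgebra.ι ℂ) ∘ₗ inc W true =
      ℓp.toLinearMap ∘ₗ π.toLinearMap ∘ₗ TensorAlgebra.ι ℂ := by
    ext x; simp [inc, hp]
  have h2 : (πD.toLinearMap ∘ₗ TensorAlgebra.ι ℂ) ∘ₗ inc W false =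
      ℓm.toLinearMap ∘ₗ π.toLinearMap ∘ₗ TensorAlgebra.ι ℂ := by
    ext x; simp [inc, hm]
  rw [h1, h2] at h
  rw [eq_sub_of_add_eq h]
  simp [formCoeff, neg_smul]
  abel

/-- The mixed relation moves the first copy of `W` to the left. -/
theorem factorization_surjective (hπ : IsPresentation ψ F π)
    (hD : IsPresentation (doubleBraid ψ) (doubleForm F) πD) :
    Function.Surjective
      (LinearMap.mul' ℂ D ∘ₗ TensorProduct.map ℓm.toLinearMap ℓp.toLinearMap) := by
  set ℓ := LinearMap.mul' ℂ D ∘ₗ TensorProduct.map ℓm.toLinearMap ℓp.toLinearMap with hℓ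
  have hmul : ∀ a b, ℓm a * ℓp b ∈ LinearMap.range ℓ := fun a b => ⟨a ⊗ₜ b, by simp [hℓ]⟩
  have hleft : ∀ a, ∀ d ∈ LinearMap.range ℓ, ℓm a * d ∈ LinearMap.range ℓ := by
    rintro a _ ⟨t, rfl⟩
    induction t with
    | zero => simp
    | tmul b c => simpa [hℓ, mul_assoc] using hmul (a * b) c
    | add s t hs ht => rw [map_add, mul_add]; exact add_mem hs ht
  have hcross : ∀ a x b, ℓp (π (TensorAlgebra.ι ℂ x)) * (ℓm a * ℓp b) ∈ LinearMap.range ℓ := by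
    intro a
    induction a using left_induction_of_surjective hπ.surjective with
    | one => intro x b; simpa using hmul 1 (π (TensorAlgebra.ι ℂ x) * b)
    | smul r a ih =>
      intro x b
      rw [map_smul, smul_mul_assoc, mul_smul_comm]
      exact Submodule.smul_mem _ _ (ih x b)
    | add a a' h h' =>
      intro x b
      rw [map_add, add_mul, mul_add]
      exact add_mem (h x b) (h' x b)
    | mul y a ih =>
      intro x b
      have h := mixed_relation hm hp hD (x ⊗ₜ y)
      simp only [tensorMul_tmul, LinearMap.comp_apply, AlgHom.toLinearMap_apply] at h
      rw [map_mul, mul_assoc, ← mul_assoc, h, sub_mul, neg_mul]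
      refine sub_mem (neg_mem ?_) ?_
      · induction ψ (x ⊗ₜ[ℂ] y) with
        | zero => simp
        | add s t hs ht => rw [map_add, add_mul]; exact add_mem hs ht
        | tmul p q =>
          rw [tensorMul_tmul, mul_assoc]
          exact hleft _ _ (ih q b)
      · rw [smul_one_mul]
        exact Submodule.smul_mem _ _ (hmul a b)
  intro d
  change d ∈ LinearMap.range ℓ
  induction d using left_induction_of_surjective hD.surjective with
  | one => simpa using hmul 1 1
  | smul r d ih => exact Submodule.smul_mem _ _ ih
  | add d d' h h' => exact add_mem h h'
  | mul v d ih =>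
    obtain ⟨t, rfl⟩ := ih
    have hv : πD (TensorAlgebra.ι ℂ v) =
        ℓm (π (TensorAlgebra.ι ℂ v.1)) + ℓp (π (TensorAlgebra.ι ℂ v.2)) := by
      rw [hm, hp, ← map_add, ← map_add]; simp
    rw [hv, add_mul]
    refine add_mem (hleft _ _ ⟨t, rfl⟩) ?_
    induction t with
    | zero => simp
    | tmul a b => simpa [hℓ] using hcross a v.2 b
    | add s t hs ht => rw [map_add, mul_add]; exact add_mem hs ht

end Factorization

/-! ### Products induced by a flip -/

section FlipMul

variable {A : Type u} {D : Type*} [Ring A] [Algebra ℂ A] [Ring D] [Algebra ℂ D]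

theorem flipMul_tmul (σ : A ⊗[ℂ] A →ₗ[ℂ] A ⊗[ℂ] A)
    (a b c d : A) : flipMul σ (a ⊗ₜ b) (c ⊗ₜ d) =
      TensorProduct.map (LinearMap.mulLeft ℂ a) (LinearMap.mulRight ℂ d) (σ (b ⊗ₜ c)) := by
  simp only [flipMul, LinearMap.comp_apply, LinearEquiv.coe_coe, TensorProduct.assoc_tmul,
    LinearMap.lTensor_tmul, TensorProduct.assoc_symm_tmul, LinearMap.rTensor_tmul]
  induction σ (b ⊗ₜ[ℂ] c) with
  | zero => simp
  | tmul p q => simp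
  | add s t hs ht => simp only [TensorProduct.add_tmul, TensorProduct.tmul_add, map_add, hs, ht]

/-- If `ℓ(a ⊗ b) = ℓ₋(a) ℓ₊(b)` turns `σ(b ⊗ c)` into `ℓ₊(b) ℓ₋(c)`, it turns the product of
`A ⊗ A` induced by `σ` into the product of `D`. -/
theorem map_flipMul {σ : A ⊗[ℂ] A →ₗ[ℂ] A ⊗[ℂ] A}
    {ℓm ℓp : A →ₐ[ℂ] D} {ℓ : A ⊗[ℂ] A →ₗ[ℂ] D} (hℓ : ∀ a b, ℓ (a ⊗ₜ b) = ℓm a * ℓp b)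
    (hσ : ∀ a b, ℓ (σ (a ⊗ₜ b)) = ℓp a * ℓm b) (p q : A ⊗[ℂ] A) :
    ℓ (flipMul σ p q) = ℓ p * ℓ q := by
  have h : ∀ a d u, ℓ (TensorProduct.map (LinearMap.mulLeft ℂ a) (LinearMap.mulRight ℂ d) u) =
      ℓm a * ℓ u * ℓp d := by
    intro a d u
    induction u with
    | zero => simp
    | tmul p q => simp [hℓ, mul_assoc]
    | add s t hs ht => simp only [map_add, mul_add, add_mul, hs, ht]
  induction p with
  | zero => simp [flipMul]
  | add p p' hp hp' =>
    rw [map_add, add_mul, ← hp, ← hp', ← map_add]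
    simp [flipMul, TensorProduct.add_tmul]
  | tmul a b =>
    induction q with
    | zero => simp [flipMul]
    | add q q' hq hq' =>
      rw [map_add, mul_add, ← hq, ← hq', ← map_add]
      simp [flipMul, TensorProduct.tmul_add]
    | tmul c d => rw [flipMul_tmul, h, hσ, hℓ, hℓ]; simp only [mul_assoc]

variable {σ : A ⊗[ℂ] A →ₗ[ℂ] A ⊗[ℂ] A} {ℓm ℓp : A →ₐ[ℂ] D} {ℓ : A ⊗[ℂ] A →ₗ[ℂ] D}

theorem map_mul_onRight (hℓ : ∀ a b, ℓ (a ⊗ₜ b) = ℓm a * ℓp b) (p q c : A) :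
    ℓ ((LinearMap.mul' ℂ A).rTensor A (onRight σ ((p ⊗ₜ q) ⊗ₜ c))) =
      ℓm p * ℓ (σ (q ⊗ₜ c)) := by
  rw [onRight_tmul]
  induction σ (q ⊗ₜ[ℂ] c) with
  | zero => simp
  | tmul a b => simp [hℓ, mul_assoc]
  | add s t hs ht => simp only [TensorProduct.tmul_add, map_add, mul_add, hs, ht]

theorem map_mul_onLeft (hℓ : ∀ a b, ℓ (a ⊗ₜ b) = ℓm a * ℓp b) (a p q : A) :
    ℓ ((LinearMap.mul' ℂ A).lTensor A (TensorProduct.assoc ℂ A A A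
      (onLeft σ ((TensorProduct.assoc ℂ A A A).symm (a ⊗ₜ (p ⊗ₜ q)))))) =
      ℓ (σ (a ⊗ₜ p)) * ℓp q := by
  rw [TensorProduct.assoc_symm_tmul, onLeft_tmul]
  induction σ (a ⊗ₜ[ℂ] p) with
  | zero => simp
  | tmul a b => simp [hℓ, mul_assoc]
  | add s t hs ht => simp only [TensorProduct.add_tmul, map_add, add_mul, hs, ht]

end FlipMul

/-! ### Flip-over operator and coproduct -/

section Flip

variable {W : Type u} [AddCommGroup W] [Module ℂ W] {ψ : W ⊗[ℂ] W →ₗ[ℂ] W ⊗[ℂ] W}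
  {F : W ⊗[ℂ] W →ₗ[ℂ] ℂ}

theorem ellF_tmul (a b : Cl ψ F) :
    ellF ψ F (a ⊗ₜ b) = ellMinus ψ F a * ellPlus ψ F b := by
  simp [ellF]

theorem ellMinus_gen (x : W) :
    ellMinus ψ F (gen ψ F x) = gen (doubleBraid ψ) (doubleForm F) (x, 0) :=
  Cl.map_gen ..

theorem ellPlus_gen (x : W) :
    ellPlus ψ F (gen ψ F x) = gen (doubleBraid ψ) (doubleForm F) (0, x) :=
  Cl.map_gen ..

theorem diagStar_gen (x : W) :
    diagStar ψ F (gen ψ F x) = gen (doubleBraid ψ) (doubleForm F) (x, x) :=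
  Cl.map_gen ..

theorem ellF_bijective (h : BraidData ψ F) : Function.Bijective (ellF ψ F) :=
  ⟨factorization_injective ellMinus_gen ellPlus_gen h (isPresentation_cl h)
      (isPresentation_cl h.double),
    factorization_surjective ellMinus_gen ellPlus_gen (isPresentation_cl h)
      (isPresentation_cl h.double)⟩

theorem ellPlus_ellMinus_gen (h : BraidData ψ F) (z : W ⊗[ℂ] W) :
    tensorMul ((ellPlus ψ F).toLinearMap ∘ₗ gen ψ F) ((ellMinus ψ F).toLinearMap ∘ₗ gen ψ F) z =
      -tensorMul ((ellMinus ψ F).toLinearMap ∘ₗ gen ψ F)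
        ((ellPlus ψ F).toLinearMap ∘ₗ gen ψ F) (ψ z) - F z • 1 :=
  mixed_relation ellMinus_gen ellPlus_gen (isPresentation_cl h.double) z

theorem ellF_map_gen (z : W ⊗[ℂ] W) :
    ellF ψ F (TensorProduct.map (gen ψ F) (gen ψ F) z) =
      tensorMul ((ellMinus ψ F).toLinearMap ∘ₗ gen ψ F)
        ((ellPlus ψ F).toLinearMap ∘ₗ gen ψ F) z := by
  induction z with
  | zero => simp
  | tmul x y => simp [ellF_tmul]
  | add a b ha hb => simp only [map_add, ha, hb]

theorem map_neg_sub {X : Type*} [AddCommGroup X] [Module ℂ X]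
    (k : Cl ψ F ⊗[ℂ] Cl ψ F →ₗ[ℂ] X) (u v : Cl ψ F ⊗[ℂ] Cl ψ F) : k (-u - v) = -k u - k v := by
  rw [map_sub]
  congr 1
  exact LinearMap.map_neg k u

/-- The flip axioms hold for an operator that corresponds under `ℓ_F` to the exchange of
`ℓ₊` and `ℓ₋`, since they hold after applying the injective `ℓ_F`. -/
theorem isFlip_of_ellF (h : BraidData ψ F) {σ : Cl ψ F ⊗[ℂ] Cl ψ F →ₗ[ℂ] Cl ψ F ⊗[ℂ] Cl ψ F}
    (hσ : ∀ a b, ellF ψ F (σ (a ⊗ₜ b)) = ellPlus ψ F a * ellMinus ψ F b) : IsFlip ψ F σ where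
  mul_right := by
    refine TensorProduct.ext_threefold fun a b c => (ellF_bijective h).1 ?_
    have key : ∀ u, ellF ψ F ((LinearMap.mul' ℂ (Cl ψ F)).rTensor (Cl ψ F)
        (onRight σ (u ⊗ₜ c))) = ellF ψ F u * ellMinus ψ F c := by
      intro u
      induction u with
      | zero => simp
      | tmul p q => rw [map_mul_onRight ellF_tmul, hσ, ellF_tmul, mul_assoc]
      | add s t hs ht => simp only [TensorProduct.add_tmul, map_add, add_mul, hs, ht]
    simp only [LinearMap.comp_apply, onLeft_tmul, key, hσ, LinearEquiv.coe_coe,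
      TensorProduct.assoc_tmul, LinearMap.lTensor_tmul, LinearMap.mul'_apply, map_mul, mul_assoc]
  mul_left := by
    refine TensorProduct.ext_threefold fun a b c => (ellF_bijective h).1 ?_
    have key : ∀ u, ellF ψ F ((LinearMap.mul' ℂ (Cl ψ F)).lTensor (Cl ψ F)
        (TensorProduct.assoc ℂ (Cl ψ F) (Cl ψ F) (Cl ψ F)
          (onLeft σ ((TensorProduct.assoc ℂ (Cl ψ F) (Cl ψ F) (Cl ψ F)).symm (a ⊗ₜ u))))) =
        ellPlus ψ F a * ellF ψ F u := by
      intro u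
      induction u with
      | zero => simp
      | tmul p q => rw [map_mul_onLeft ellF_tmul, hσ, ellF_tmul, mul_assoc]
      | add s t hs ht => simp only [TensorProduct.tmul_add, map_add, mul_add, hs, ht]
    simp only [LinearMap.comp_apply, onRight_tmul, LinearEquiv.coe_coe, key, hσ,
      LinearMap.rTensor_tmul, LinearMap.mul'_apply, map_mul, mul_assoc]
  one_left a := (ellF_bijective h).1 (by rw [hσ, ellF_tmul]; simp)
  one_right a := (ellF_bijective h).1 (by rw [hσ, ellF_tmul]; simp)
  gen_gen x y := (ellF_bijective h).1 (by
    have := ellPlus_ellMinus_gen h (x ⊗ₜ y)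
    simp only [tensorMul_tmul, LinearMap.comp_apply, AlgHom.toLinearMap_apply] at this
    rw [hσ, this, map_neg_sub, ellF_map_gen, map_smul, ellF_tmul, map_one, map_one, one_mul])

/-- The flip axioms determine `ℓ_F ∘ σ`: `mul_right` and `gen_gen` give the value on `x ⊗ b` for
`x ∈ W` by induction on `b`, and `mul_left` then gives it on `a ⊗ b` by induction on `a`. -/
theorem IsFlip.ellF_apply (h : BraidData ψ F)
    {σ : Cl ψ F ⊗[ℂ] Cl ψ F →ₗ[ℂ] Cl ψ F ⊗[ℂ] Cl ψ F} (hσ : IsFlip ψ F σ) (a b : Cl ψ F) :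
    ellF ψ F (σ (a ⊗ₜ b)) = ellPlus ψ F a * ellMinus ψ F b := by
  have hsurj := (isPresentation_cl h).surjective
  have hgen : ∀ b x, ellF ψ F (σ (gen ψ F x ⊗ₜ b)) =
      ellPlus ψ F (gen ψ F x) * ellMinus ψ F b := by
    intro b
    induction b using left_induction_of_surjective hsurj with
    | one => intro x; rw [hσ.one_right, ellF_tmul]; simp
    | smul c b ih => intro x; rw [TensorProduct.tmul_smul]; simp [ih]
    | add b b' hb hb' => intro x; rw [TensorProduct.tmul_add]; simp [hb, hb', mul_add]
    | mul y b ih =>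
      intro x
      change ellF ψ F (σ (gen ψ F x ⊗ₜ (gen ψ F y * b))) =
        ellPlus ψ F (gen ψ F x) * ellMinus ψ F (gen ψ F y * b)
      have h1 := LinearMap.congr_fun hσ.mul_right ((gen ψ F x ⊗ₜ gen ψ F y) ⊗ₜ b)
      simp only [LinearMap.comp_apply, onLeft_tmul, LinearEquiv.coe_coe,
        TensorProduct.assoc_tmul, LinearMap.lTensor_tmul, LinearMap.mul'_apply] at h1
      have h2 : ∀ z, ellF ψ F ((LinearMap.mul' ℂ (Cl ψ F)).rTensor (Cl ψ F)
          (onRight σ (TensorProduct.map (gen ψ F) (gen ψ F) z ⊗ₜ b))) =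
          tensorMul ((ellMinus ψ F).toLinearMap ∘ₗ gen ψ F)
            ((ellPlus ψ F).toLinearMap ∘ₗ gen ψ F) z * ellMinus ψ F b := by
        intro z
        induction z with
        | zero => simp
        | tmul p q =>
          rw [TensorProduct.map_tmul, map_mul_onRight ellF_tmul, ih, tensorMul_tmul, mul_assoc]
          rfl
        | add s t hs ht => simp only [TensorProduct.add_tmul, map_add, add_mul, hs, ht]
      have h3 := ellPlus_ellMinus_gen h (x ⊗ₜ y)
      simp only [tensorMul_tmul, LinearMap.comp_apply, AlgHom.toLinearMap_apply] at h3
      have h4 := map_neg_sub (ellF ψ F ∘ₗ (LinearMap.mul' ℂ (Cl ψ F)).rTensor (Cl ψ F) ∘ₗ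
        onRight σ ∘ₗ (TensorProduct.mk ℂ (Cl ψ F ⊗[ℂ] Cl ψ F) (Cl ψ F)).flip b)
        (TensorProduct.map (gen ψ F) (gen ψ F) (ψ (x ⊗ₜ y))) (F (x ⊗ₜ y) • (1 ⊗ₜ 1))
      rw [map_smul] at h4
      simp only [LinearMap.comp_apply, LinearMap.flip_apply, TensorProduct.mk_apply, h2] at h4
      rw [map_mul_onRight ellF_tmul, hσ.one_left, ellF_tmul] at h4
      rw [← h1, hσ.gen_gen, map_mul, ← mul_assoc, h3, h4, sub_mul, smul_one_mul, map_one,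
        map_one, one_mul, mul_one]
      congr 1
      exact (neg_mul (α := Cl (doubleBraid ψ) (doubleForm F)) _ _).symm
  induction a using left_induction_of_surjective hsurj generalizing b with
  | one => rw [hσ.one_left, ellF_tmul]; simp
  | smul c a ih => rw [← TensorProduct.smul_tmul']; simp [ih]
  | add a a' ha ha' => rw [TensorProduct.add_tmul]; simp [ha, ha', add_mul]
  | mul x a ih =>
    change ellF ψ F (σ ((gen ψ F x * a) ⊗ₜ b)) =
      ellPlus ψ F (gen ψ F x * a) * ellMinus ψ F b
    have h1 := LinearMap.congr_fun hσ.mul_left ((gen ψ F x ⊗ₜ a) ⊗ₜ b)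
    simp only [LinearMap.comp_apply, onRight_tmul, LinearEquiv.coe_coe,
      LinearMap.rTensor_tmul, LinearMap.mul'_apply] at h1
    have h2 : ∀ u, ellF ψ F ((LinearMap.mul' ℂ (Cl ψ F)).lTensor (Cl ψ F)
        (TensorProduct.assoc ℂ (Cl ψ F) (Cl ψ F) (Cl ψ F)
          (onLeft σ ((TensorProduct.assoc ℂ (Cl ψ F) (Cl ψ F) (Cl ψ F)).symm
            (gen ψ F x ⊗ₜ u))))) = ellPlus ψ F (gen ψ F x) * ellF ψ F u := by
      intro u
      induction u with
      | zero => simp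
      | tmul p q => rw [map_mul_onLeft ellF_tmul, hgen, ellF_tmul, mul_assoc]
      | add s t hs ht => simp only [TensorProduct.tmul_add, map_add, mul_add, hs, ht]
    rw [← h1, h2, ih, map_mul, mul_assoc]

theorem IsFlip.ellF_flipMul (h : BraidData ψ F)
    {σ : Cl ψ F ⊗[ℂ] Cl ψ F →ₗ[ℂ] Cl ψ F ⊗[ℂ] Cl ψ F} (hσ : IsFlip ψ F σ)
    (p q : Cl ψ F ⊗[ℂ] Cl ψ F) : ellF ψ F (flipMul σ p q) = ellF ψ F p * ellF ψ F q :=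
  map_flipMul ellF_tmul (hσ.ellF_apply h) p q

theorem ellF_one : ellF ψ F (1 ⊗ₜ 1) = 1 := by simp [ellF_tmul]

theorem existsUnique_isFlip (h : BraidData ψ F) :
    ∃! σ : Cl ψ F ⊗[ℂ] Cl ψ F →ₗ[ℂ] Cl ψ F ⊗[ℂ] Cl ψ F, IsFlip ψ F σ := by
  let e := LinearEquiv.ofBijective (ellF ψ F) (ellF_bijective h)
  refine ⟨e.symm.toLinearMap ∘ₗ LinearMap.mul' ℂ _ ∘ₗ
    TensorProduct.map (ellPlus ψ F).toLinearMap (ellMinus ψ F).toLinearMap,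
    isFlip_of_ellF h fun a b => ?_, fun σ hσ => ?_⟩
  · exact e.apply_symm_apply _
  · refine TensorProduct.ext' fun a b => (ellF_bijective h).1 ?_
    rw [hσ.ellF_apply h]
    exact (e.apply_symm_apply _).symm

theorem IsCoproduct.ellF_apply (h : BraidData ψ F)
    {σ : Cl ψ F ⊗[ℂ] Cl ψ F →ₗ[ℂ] Cl ψ F ⊗[ℂ] Cl ψ F} (hσ : IsFlip ψ F σ)
    {φ : Cl ψ F →ₗ[ℂ] Cl ψ F ⊗[ℂ] Cl ψ F} (hφ : IsCoproduct ψ F σ φ) (a : Cl ψ F) :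
    ellF ψ F (φ a) = diagStar ψ F a := by
  induction a using left_induction_of_surjective (isPresentation_cl h).surjective with
  | one => rw [hφ.map_one, ellF_one, _root_.map_one]
  | smul c a ih => simp [ih]
  | add a b ha hb => simp [ha, hb]
  | mul x a ih =>
    change ellF ψ F (φ (gen ψ F x * a)) = diagStar ψ F (gen ψ F x * a)
    rw [hφ.map_mul, hσ.ellF_flipMul h, ih, hφ.map_gen, map_add, ellF_tmul, ellF_tmul, _root_.map_mul,
      ellMinus_gen, ellPlus_gen, diagStar_gen, _root_.map_one, _root_.map_one, one_mul, mul_one, ← map_add]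
    simp

theorem existsUnique_isCoproduct (h : BraidData ψ F)
    {σ : Cl ψ F ⊗[ℂ] Cl ψ F →ₗ[ℂ] Cl ψ F ⊗[ℂ] Cl ψ F} (hσ : IsFlip ψ F σ) :
    ∃! φ : Cl ψ F →ₗ[ℂ] Cl ψ F ⊗[ℂ] Cl ψ F, IsCoproduct ψ F σ φ := by
  let e := LinearEquiv.ofBijective (ellF ψ F) (ellF_bijective h)
  have he : ∀ d, ellF ψ F (e.symm d) = d := e.apply_symm_apply
  refine ⟨e.symm.toLinearMap ∘ₗ (diagStar ψ F).toLinearMap, ⟨?_, fun a b => ?_, fun x => ?_⟩,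
    fun φ hφ => LinearMap.ext fun a => (ellF_bijective h).1 ?_⟩
  · refine (ellF_bijective h).1 ?_
    simp [he, ellF_one]
  · refine (ellF_bijective h).1 ?_
    rw [hσ.ellF_flipMul h]
    simp [he]
  · refine (ellF_bijective h).1 ?_
    simp only [LinearMap.comp_apply, LinearEquiv.coe_coe, he, AlgHom.toLinearMap_apply, map_add,
      ellF_tmul, map_one, one_mul, mul_one, ellMinus_gen, ellPlus_gen, diagStar_gen]
    rw [← map_add]
    simp
  · rw [hφ.ellF_apply h hσ]
    simp [he]

end Flip

end BraidedCliff

open BraidedCliff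
theorem lemma8 {W : Type*} [AddCommGroup W] [Module ℂ W] [FiniteDimensional ℂ W]
    (ψ : W ⊗[ℂ] W →ₗ[ℂ] W ⊗[ℂ] W) (F : W ⊗[ℂ] W →ₗ[ℂ] ℂ)
    (hbraid : BraidEquation ψ) (hinv : ψ ∘ₗ ψ = LinearMap.id)
    (hcov : CovariantForm ψ F) (hsymm : F ∘ₗ ψ = F) :
    (∃! σ : Cl ψ F ⊗[ℂ] Cl ψ F →ₗ[ℂ] Cl ψ F ⊗[ℂ] Cl ψ F, IsFlip ψ F σ) ∧
    ∀ σ : Cl ψ F ⊗[ℂ] Cl ψ F →ₗ[ℂ] Cl ψ F ⊗[ℂ] Cl ψ F, IsFlip ψ F σ →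
      ((∀ p q r, flipMul σ (flipMul σ p q) r = flipMul σ p (flipMul σ q r)) ∧
        (∀ p, flipMul σ (1 ⊗ₜ 1) p = p) ∧ (∀ p, flipMul σ p (1 ⊗ₜ 1) = p)) ∧
      (Function.Bijective (ellF ψ F) ∧ ellF ψ F (1 ⊗ₜ 1) = 1 ∧
        ∀ p q, ellF ψ F (flipMul σ p q) = ellF ψ F p * ellF ψ F q) ∧
      (∃! φ : Cl ψ F →ₗ[ℂ] Cl ψ F ⊗[ℂ] Cl ψ F, IsCoproduct ψ F σ φ) ∧
      ∀ φ : Cl ψ F →ₗ[ℂ] Cl ψ F ⊗[ℂ] Cl ψ F, IsCoproduct ψ F σ φ →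
        (diagStar ψ F).toLinearMap = ellF ψ F ∘ₗ φ := by
  have h : BraidData ψ F := ⟨hbraid, hinv, hcov, hsymm⟩
  have hinj := (ellF_bijective h).1
  refine ⟨existsUnique_isFlip h, fun σ hσ => ?_⟩
  have hmul := hσ.ellF_flipMul h
  refine ⟨⟨fun p q r => hinj ?_, fun p => hinj ?_, fun p => hinj ?_⟩,
    ⟨ellF_bijective h, ellF_one, hmul⟩, existsUnique_isCoproduct h hσ, fun φ hφ => ?_⟩
  · simp only [hmul, mul_assoc]
  · rw [hmul, ellF_one, one_mul]
  · rw [hmul, ellF_one, mul_one]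
  · exact LinearMap.ext fun a => (hφ.ellF_apply h hσ a).symm
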